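/- Let $K$ be a biquadratic bicyclic number field, that is, a Galois extension of $\mathbb{Q}$ with $\mathrm{Gal}(K/\mathbb{Q})\simeq(\mathbb{Z}/2\mathbb{Z})^2$, and let $k_1,k_2,k_3$ be its three quadratic subfields. For a number field $k$ with ring of integers $\mathcal{O}_k$, and for a positive integer $q$, let $\Pi_q(k)$ be the product of all prime ideals of $\mathcal{O}_k$ with norm $q$ (with $\Pi_q(k)=\mathcal{O}_k$ if there are none), and let the Pólya group $\mathcal{P}o(k)$ be the subgroup of the class group of $k$ generated by the classes of the ideals $\Pi_q(k)$. Let $$q_K=(\mathcal{O}_K^\times:\mathcal{O}_{k_1}^\times\mathcal{O}_{k_2}^\times\mathcal{O}_{k_3}^\times)$$ be the unit index of $K$, let $e_p(K/\mathbb{Q})$ be the ramification index of the prime number $p$ in $K/\mathbb{Q}$, and for $i=1,2,3$ let $\nu_i=1$ if $k_i$ is real and its fundamental unit $\varepsilon_i>1$ has norm $N_{k_i/\mathbb{Q}}(\varepsilon_i)=+1$, and $\nu_i=0$ otherwise. **Theorem (Kubota, Satz 4).** The map $(\mathfrak{a}_1,\mathfrak{a}_2,\mathfrak{a}_3)\mapsto\mathfrak{a}_1\mathfrak{a}_2\mathfrak{a}_3\mathcal{O}_K$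 on ideals induces a group homomorphism $$\psi:\mathcal{P}o(k_1)\times\mathcal{P}o(k_2)\times\mathcal{P}o(k_3)\to\mathcal{P}o(K),$$ and its kernel has order $$|\mathrm{Ker}\,\psi|=\begin{cases}\dfrac{1}{q_K}\displaystyle\prod_p e_p(K/\mathbb{Q}) & \text{if } K \text{ is real and } \nu_1=\nu_2=\nu_3=0,\\[2ex] \dfrac{1}{2q_K}\displaystyle\prod_p e_p(K/\mathbb{Q}) & \text{otherwise,}\end{cases}$$ where the products run over all prime numbers $p$. -/

import Mathlib

open NumberField

noncomputable section

namespace Biquadratic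

/-- `Π_q(k)`: the product of all the prime ideals of `𝓞 k` with norm `q`
(the empty product, i.e. the unit ideal, if there are none). -/
def polyaIdeal (k : Type*) [Field k] [NumberField k] (q : ℕ) : Ideal (𝓞 k) :=
  ∏ᶠ P ∈ {P : Ideal (𝓞 k) | P.IsPrime ∧ P ≠ ⊥ ∧ Ideal.absNorm P = q}, P

/-- The product above is a finite one. -/
theorem finite_primes_absNorm_eq (k : Type*) [Field k] [NumberField k] (q : ℕ) :
    {P : Ideal (𝓞 k) | P.IsPrime ∧ P ≠ ⊥ ∧ Ideal.absNorm P = q}.Finite :=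
  (Ideal.finite_setOfPred_absNorm_eq (S := 𝓞 k) q).subset fun _ hP => hP.2.2

theorem polyaIdeal_mem_nonZeroDivisors (k : Type*) [Field k] [NumberField k] (q : ℕ) :
    polyaIdeal k q ∈ nonZeroDivisors (Ideal (𝓞 k)) :=
  finprod_mem_induction (· ∈ nonZeroDivisors (Ideal (𝓞 k))) (one_mem _)
    (fun _ _ hx hy => mul_mem hx hy)
    (fun _ hP => mem_nonZeroDivisors_iff_ne_zero.mpr hP.2.1)

/-- The Pólya group `Po(k)`: the subgroup of the class group of `k` generated by the classes
of the ideals `Π_q(k)`. -/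
def polyaGroup (k : Type*) [Field k] [NumberField k] : Subgroup (ClassGroup (𝓞 k)) :=
  Subgroup.closure (Set.range fun q : ℕ =>
    ClassGroup.mk0 ⟨polyaIdeal k q, polyaIdeal_mem_nonZeroDivisors k q⟩)

/-- `ε` is the fundamental unit `> 1` of the real quadratic field `k`, where `k` is viewed as a
subfield of `ℝ` through `φ`: every unit is `± ε ^ n` for some integer `n`, and `ε > 1`. -/
def IsFundamentalUnit {k : Type*} [Field k] (φ : k →+* ℝ) (ε : (𝓞 k)ˣ) : Prop :=
  1 < φ (ε : k) ∧ ∀ u : (𝓞 k)ˣ, ∃ n : ℤ, u = ε ^ n ∨ u = -ε ^ n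

open scoped Classical in
/-- `ν = 1` if the quadratic field `k` is real and its fundamental unit has norm `+1`,
and `ν = 0` otherwise. -/
def nu (k : Type*) [Field k] [NumberField k] : ℕ :=
  if ∃ (φ : k →+* ℝ) (ε : (𝓞 k)ˣ), IsFundamentalUnit φ ε ∧ Algebra.norm ℚ (ε : k) = 1
  then 1 else 0

section

variable {K : Type*} [Field K] [NumberField K] (k : Fin 3 → IntermediateField ℚ K)

/-- The unit index `q_K = (𝓞 Kˣ : 𝓞 k₁ˣ 𝓞 k₂ˣ 𝓞 k₃ˣ)`. -/
def unitIndex : ℕ :=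
  (⨆ i, (Units.map (algebraMap (𝓞 (k i)) (𝓞 K)).toMonoidHom).range : Subgroup (𝓞 K)ˣ).index

/-- The homomorphism `Po(k₁) × Po(k₂) × Po(k₃) → Cl(K)` induced by the map
`(𝔞₁, 𝔞₂, 𝔞₃) ↦ 𝔞₁ 𝔞₂ 𝔞₃ 𝓞 K` on ideals. -/
def extendClasses : (∀ i, polyaGroup (k i)) →* ClassGroup (𝓞 K) :=
  ∏ i, (ClassGroup.extendedHom (𝓞 (k i)) (𝓞 K)).comp
    ((polyaGroup (k i)).subtype.comp (Pi.evalMonoidHom (fun i => polyaGroup (k i)) i))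

/-- The homomorphism `ψ : Po(k₁) × Po(k₂) × Po(k₃) → Po(K)` induced by extension of ideals,
once it is known that extension of ideals takes Pólya classes to Pólya classes. -/
def psi (h : ∀ x, extendClasses k x ∈ polyaGroup K) :
    (∀ i, polyaGroup (k i)) →* polyaGroup K :=
  (extendClasses k).codRestrict (polyaGroup K) h

end

/-- The product `∏_p e_p(K/ℚ)` of the ramification indices in the Galois number field `K` of all
prime numbers (almost all factors are `1`). -/
def ramificationProduct (K : Type*) [Field K] [NumberField K] : ℕ :=
  ∏ᶠ p : Nat.Primes, (Ideal.span {((p : ℕ) : ℤ)}).ramificationIdxIn (𝓞 K)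

end Biquadratic

end

/-! Over a Galois field `k` the primes above `p` have a common norm, so Po(k) is generated by the
classes of the radicals `radIdeal k p`, where (p) is the radical to the power `ramIdx k p`. The
proof works with the ideals whose square is rational (`sqrtRatIdeals`) and with their classes C(k)
(`sqrtClasses`). If all ramification indices are at most 2, as in the quadratic fields, then C(k) =
Po(k). In K an index may be 4 and only C(K) ≤ Po(K) is claimed, but C(K) is exactly the image of ψ
(`range_extendClasses`). Hence |Ker ψ| · |C(K)| = ∏ |C(k_i)|.

To count C(k): modulo rational ideals, the ideals with rational square form a group of order 2^t,
where t is the number of primes with even ramification index. If X is the order of the subgroup of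
principal ones, then X · |C(k)| = 2^t. To find X, let U be the image of the units in A = kˣ/ℚˣ and T
= {a | a² ∈ U}. Then [T : U] [U : T²] = 2^rank · |A[2]|. Here [T : U] = X, and [U : T²] is the index
V of the units that are rational multiples of squares (`ratSqUnits`). By Hilbert 90, A[2] is the
group of quadratic characters of the Galois group. So X V = 2^rank · |Gal|.

The unit rank of K is the sum of those of the k_i, and every ramified p satisfies 2 e_p(K) = ∏
e_p(k_i). Everything cancels to |Ker ψ| = ∏ e_p · ∏ V_i / (2 V_K). Finally V_K · c = q_K · ∏ V_i
(`index_ratSqUnits_mul_card`), where c counts the sign vectors (N u_1, N u_2, N u_3) of the triples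
whose product is a rational multiple of a square in K. One has c = 2 when K is real and each k_i has
a unit of norm -1, and c = 1 otherwise. -/

noncomputable section

/-! ### Doubling on abelian groups -/

open Module in
/-- For a finitely generated abelian group `M`, the index of `2 • M` is `2 ^ rank M` times the order
of the `2`-torsion of `M`. -/
theorem AddCommGroup.index_range_two_nsmul (M : Type*) [AddCommGroup M] [Module.Finite ℤ M] :
    (nsmulAddMonoidHom (α := M) 2).range.index =
      2 ^ finrank ℤ M * Nat.card (nsmulAddMonoidHom (α := M) 2).ker := by
  have hfg : AddGroup.FG M := Module.Finite.iff_addGroup_fg.mp inferInstance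
  obtain ⟨n, ι, _, p, hp, e, ⟨f⟩⟩ := AddCommGroup.equiv_free_prod_directSum_zmod M
  set A := Fin n →₀ ℤ
  set F := DirectSum ι fun i => ZMod (p i ^ e i)
  have : ∀ i, NeZero (p i ^ e i) := fun i => ⟨pow_ne_zero _ (hp i).ne_zero⟩
  have hF : Finite F :=
    Finite.of_equiv _ (DirectSum.addEquivProd fun i => ZMod (p i ^ e i)).symm.toEquiv
  have hrange : (nsmulAddMonoidHom (α := M) 2).range.map f.toAddMonoidHom =
      (nsmulAddMonoidHom (α := A) 2).range.prod (nsmulAddMonoidHom (α := F) 2).range := by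
    rw [← AddMonoidHom.range_prodMap]
    ext x
    constructor
    · rintro ⟨_, ⟨y, rfl⟩, rfl⟩
      exact ⟨f y, by ext <;> simp⟩
    · rintro ⟨y, rfl⟩
      exact ⟨_, ⟨f.symm y, rfl⟩, by simp; rfl⟩
  have hker : (nsmulAddMonoidHom (α := M) 2).ker.map f.toAddMonoidHom =
      (nsmulAddMonoidHom (α := A) 2).ker.prod (nsmulAddMonoidHom (α := F) 2).ker := by
    rw [← AddMonoidHom.ker_prodMap]
    ext x
    constructor
    · rintro ⟨y, hy, rfl⟩
      have : 2 • y = 0 := hy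
      have h2 : 2 • f y = 0 := by rw [← map_nsmul, this, map_zero]
      exact h2
    · intro hx
      have hx : 2 • x = 0 := hx
      exact ⟨f.symm x, by
        change 2 • f.symm x = 0
        rw [← map_nsmul, hx, map_zero], by simp⟩
  have hkerA : (nsmulAddMonoidHom (α := A) 2).ker = ⊥ :=
    (AddMonoidHom.ker_eq_bot_iff _).mpr
      (AddSubgroup.nsmulAddMonoidHom_injective_of_isTorsionFree two_ne_zero)
  -- An endomorphism of a finite group has kernel and cokernel of the same order.
  have hFin : (nsmulAddMonoidHom (α := F) 2).range.index =
      Nat.card (nsmulAddMonoidHom (α := F) 2).ker := by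
    have h1 := (nsmulAddMonoidHom (α := F) 2).range.card_mul_index
    have h2 := (nsmulAddMonoidHom (α := F) 2).ker.card_mul_index
    rw [AddSubgroup.index_ker, ← h1, mul_comm] at h2
    exact (Nat.eq_of_mul_eq_mul_left Nat.card_pos h2).symm
  have hrank : finrank ℤ M = finrank ℤ A := by
    rw [f.toIntLinearEquiv.finrank_eq]
    rw [← (LinearMap.fst ℤ A F).quotKerEquivOfSurjective (fun a => ⟨(a, 0), rfl⟩) |>.finrank_eq]
    refine (finrank_quotient_eq_of_le_torsion fun x hx => ?_).symm
    have hx1 : x.1 = 0 := hx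
    refine ⟨⟨(Nat.card F : ℤ),
      mem_nonZeroDivisors_of_ne_zero (by exact_mod_cast Nat.card_pos.ne')⟩, ?_⟩
    change (Nat.card F : ℤ) • x = 0
    rw [natCast_zsmul]
    ext1
    · simp [hx1]
    · exact card_nsmul_eq_zero'
  have hidx := AddSubgroup.index_map_equiv (nsmulAddMonoidHom (α := M) 2).range f
  have hcard := Nat.card_congr ((nsmulAddMonoidHom (α := M) 2).ker.equivMapOfInjective
    f.toAddMonoidHom f.injective).toEquiv
  rw [hker, hkerA] at hcard
  change ((nsmulAddMonoidHom (α := M) 2).range.map f.toAddMonoidHom).index = _ at hidx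
  rw [← hidx, hrange, AddSubgroup.index_prod, AddSubgroup.index_range_nsmul, hFin, hrank, hcard,
    Nat.card_congr (AddSubgroup.prodEquiv _ _).toEquiv, Nat.card_prod, AddSubgroup.card_bot,
    one_mul]

open Module in
/-- If `U` is a finitely generated subgroup of an abelian group `A` with finite `2`-torsion and
`T = {a | 2 a ∈ U}`, then `[T : U] [U : 2 T] = 2 ^ rank U * |A[2]|`. -/
theorem AddSubgroup.relIndex_comap_two_nsmul_mul {A : Type*} [AddCommGroup A] (U : AddSubgroup A)
    [Module.Finite ℤ U] [hA : Finite (nsmulAddMonoidHom (α := A) 2).ker] :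
    U.relIndex (U.comap (nsmulAddMonoidHom 2)) *
        ((U.comap (nsmulAddMonoidHom 2)).map (nsmulAddMonoidHom 2)).relIndex U =
      2 ^ finrank ℤ U * Nat.card (nsmulAddMonoidHom (α := A) 2).ker := by
  set s := nsmulAddMonoidHom (α := A) 2
  set T := U.comap s
  have hUT : U ≤ T := fun u hu => U.nsmul_mem hu 2
  have hVU : T.map s ≤ U := AddSubgroup.map_comap_le _ _
  let g : T →ₗ[ℤ] U := ((s.comp T.subtype).codRestrict U fun x => x.2).toIntLinearMap
  have hker : ∀ x : T, x ∈ LinearMap.ker g ↔ 2 • x = 0 := fun x =>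
    ⟨fun h => Subtype.ext (congrArg (fun y : U => (y : A)) (show g x = 0 from h)),
      fun h => show g x = 0 from Subtype.ext (congrArg (fun y : T => (y : A)) h)⟩
  -- `T` is finitely generated because doubling maps it into `U` with finite kernel.
  have hfinker : Finite (LinearMap.ker g) :=
    Finite.of_injective (β := s.ker)
      (fun x => ⟨x.1.1, congrArg (fun y : U => (y : A)) (show g x.1 = 0 from x.2)⟩)
      fun x y h => Subtype.ext (Subtype.ext (congrArg (fun y : s.ker => (y : A)) h))
  have : Module.Finite ℤ (T ⧸ LinearMap.ker g) :=
    Module.Finite.equiv g.quotKerEquivRange.symm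
  have : Module.Finite ℤ T := Module.Finite.of_submodule_quotient (LinearMap.ker g)
  have hrank : finrank ℤ T = finrank ℤ U := by
    refine le_antisymm ?_ ?_
    · have h1 : finrank ℤ (T ⧸ LinearMap.ker g) = finrank ℤ T :=
        finrank_quotient_eq_of_le_torsion fun x hx =>
          ⟨⟨2, mem_nonZeroDivisors_of_ne_zero two_ne_zero⟩, by
            change (2 : ℤ) • x = 0
            rw [ofNat_zsmul]; exact (hker x).mp hx⟩
      rw [← h1, g.quotKerEquivRange.finrank_eq]
      exact Submodule.finrank_le _
    · exact LinearMap.finrank_le_finrank_of_injective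
        (f := (AddSubgroup.inclusion hUT).toIntLinearMap) (AddSubgroup.inclusion_injective hUT)
  -- `[T : 2T] = [T : U] [U : 2T]`, and `T` contains all the 2-torsion of `A` because `0 ∈ U`.
  have key := AddCommGroup.index_range_two_nsmul T
  have hcard : Nat.card (nsmulAddMonoidHom (α := T) 2).ker = Nat.card s.ker := by
    refine Nat.card_congr
      { toFun x := ⟨x.1.1, congrArg Subtype.val (show 2 • x.1 = 0 from x.2)⟩
        invFun x := ⟨⟨x.1, ?_⟩, Subtype.ext (show 2 • x.1 = 0 from x.2)⟩
        left_inv _ := rfl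
        right_inv _ := rfl }
    change 2 • x.1 ∈ U
    rw [show 2 • x.1 = 0 from x.2]
    exact zero_mem U
  have hmap : (nsmulAddMonoidHom (α := T) 2).range = (T.map s).addSubgroupOf T := by
    ext x
    constructor
    · rintro ⟨y, rfl⟩
      exact ⟨y.1, y.2, rfl⟩
    · rintro ⟨y, hy, hyx⟩
      exact ⟨⟨y, hy⟩, Subtype.ext hyx⟩
  rw [hmap, hcard, hrank] at key
  rw [← key, mul_comm]
  exact AddSubgroup.relIndex_mul_relIndex _ _ _ hVU hUT

namespace Biquadratic

open nonZeroDivisors NumberField.Units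

/-! ### The group `kˣ / ℚˣ` and the units -/

section

variable (k : Type*) [Field k]

/-- The nonzero rational numbers, as a subgroup of the units of `k`. -/
def ratUnits [CharZero k] : Subgroup kˣ :=
  (Units.map (algebraMap ℚ k).toMonoidHom).range

/-- The group of fractional ideals of `k` generated by rational numbers. -/
def ratIdeals [NumberField k] : Subgroup (FractionalIdeal (𝓞 k)⁰ k)ˣ :=
  (ratUnits k).map (toPrincipalIdeal (𝓞 k) k)

/-- The group of fractional ideals of `k` whose square is generated by a rational number. -/
def sqrtRatIdeals [NumberField k] : Subgroup (FractionalIdeal (𝓞 k)⁰ k)ˣ :=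
  (ratIdeals k).comap (powMonoidHom 2)

/-- The group of units of `k` which are a rational number times a square. -/
def ratSqUnits [NumberField k] : Subgroup (𝓞 k)ˣ :=
  (ratUnits k ⊔ (powMonoidHom 2 : kˣ →* kˣ).range).comap
    (Units.map (algebraMap (𝓞 k) k).toMonoidHom)

theorem mem_ratUnits [CharZero k] {x : kˣ} : x ∈ ratUnits k ↔ ∃ r : ℚ, (x : k) = r := by
  constructor
  · rintro ⟨r, rfl⟩
    exact ⟨r, rfl⟩
  · rintro ⟨r, hr⟩
    have h0 : r ≠ 0 := by
      rintro rfl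
      simp at hr
    exact ⟨Units.mk0 r h0, Units.ext hr.symm⟩

variable [NumberField k]

theorem mem_ratSqUnits {u : (𝓞 k)ˣ} :
    u ∈ ratSqUnits k ↔ ∃ (r : ℚ) (α : k), (u : k) = r * α ^ 2 := by
  constructor
  · intro h
    obtain ⟨x, hx, _, ⟨α, rfl⟩, h⟩ := Subgroup.mem_sup.mp (Subgroup.mem_comap.mp h)
    obtain ⟨r, hr⟩ := (mem_ratUnits k).mp hx
    exact ⟨r, α, by rw [← hr]; exact (congrArg Units.val h).symm⟩
  · rintro ⟨r, α, h⟩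
    have h0 : (u : k) ≠ 0 := coe_ne_zero u
    have hα : α ≠ 0 := by rintro rfl; simp at h
    have hr : (r : k) ≠ 0 := by intro hr; simp [hr] at h
    refine Subgroup.mem_comap.mpr (Subgroup.mem_sup.mpr
      ⟨Units.mk0 _ hr, (mem_ratUnits k).mpr ⟨r, rfl⟩, _, ⟨Units.mk0 α hα, rfl⟩, Units.ext ?_⟩)
    exact h.symm

theorem toPrincipalIdeal_eq_one_iff {x : kˣ} :
    toPrincipalIdeal (𝓞 k) k x = 1 ↔
      x ∈ (Units.map (algebraMap (𝓞 k) k).toMonoidHom).range := by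
  rw [toPrincipalIdeal_eq_iff, Units.val_one, ← FractionalIdeal.spanSingleton_one, eq_comm,
    FractionalIdeal.spanSingleton_eq_spanSingleton]
  constructor
  · rintro ⟨z, hz⟩
    refine ⟨z, Units.ext ?_⟩
    rw [← hz, Units.smul_def, Algebra.smul_def, mul_one]
    rfl
  · rintro ⟨z, rfl⟩
    exact ⟨z, by rw [Units.smul_def, Algebra.smul_def, mul_one]; rfl⟩

/-- The norm of a rational unit `r` is a power of `r` with absolute value 1, so `r = ±1`. -/
theorem sq_eq_one_of_mem_ratUnits {u : (𝓞 k)ˣ}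
    (hu : Units.map (algebraMap (𝓞 k) k).toMonoidHom u ∈ ratUnits k) : u ^ 2 = 1 := by
  obtain ⟨r, hr⟩ := (mem_ratUnits k).mp hu
  have hr : (u : k) = algebraMap ℚ k r := by simpa using hr
  have h1 := NumberField.Units.norm k u
  rw [hr, Algebra.norm_algebraMap, abs_pow,
    pow_eq_one_iff_of_nonneg (abs_nonneg _) Module.finrank_pos.ne'] at h1
  have h2 : r ^ 2 = 1 := by rw [← sq_abs, h1, one_pow]
  apply NumberField.Units.coe_injective
  beta_reduce
  rw [coe_pow, hr, ← map_pow, h2, map_one, coe_one]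

/-- The group `kˣ / ℚˣ`. -/
def RatClass : Type _ := kˣ ⧸ ratUnits k

instance : CommGroup (RatClass k) := QuotientGroup.Quotient.commGroup (ratUnits k)

/-- The projection `kˣ → kˣ / ℚˣ`. -/
def RatClass.mk : kˣ →* RatClass k := QuotientGroup.mk' (ratUnits k)

theorem RatClass.mk_surjective : Function.Surjective (RatClass.mk k) :=
  QuotientGroup.mk'_surjective (ratUnits k)

theorem RatClass.ker_mk : (RatClass.mk k).ker = ratUnits k := QuotientGroup.ker_mk' (ratUnits k)

theorem RatClass.mk_eq_one_iff {x : kˣ} : RatClass.mk k x = 1 ↔ x ∈ ratUnits k :=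
  QuotientGroup.eq_one_iff x

/-- The image of the units of `k` in `kˣ / ℚˣ`. -/
def unitsModRat : (𝓞 k)ˣ →* RatClass k :=
  (RatClass.mk k).comp (Units.map (algebraMap (𝓞 k) k).toMonoidHom)

/-- Only torsion is lost on passing to `kˣ / ℚˣ`, so the rank is unchanged. -/
theorem finrank_range_unitsModRat :
    Module.finrank ℤ (Additive (unitsModRat k).range) = Units.rank k := by
  let g : Additive (𝓞 k)ˣ →ₗ[ℤ] Additive (unitsModRat k).range :=
    (MonoidHom.toAdditive (unitsModRat k).rangeRestrict).toIntLinearMap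
  have hg : Function.Surjective g := (unitsModRat k).rangeRestrict_surjective
  rw [← NumberField.Units.finrank_eq, ← (g.quotKerEquivOfSurjective hg).finrank_eq]
  refine finrank_quotient_eq_of_le_torsion fun u hu =>
    ⟨⟨2, mem_nonZeroDivisors_of_ne_zero two_ne_zero⟩, ?_⟩
  change (2 : ℤ) • u = 0
  rw [ofNat_zsmul]
  have h1 : unitsModRat k u.toMul = 1 :=
    congrArg (fun y : (unitsModRat k).range => (y : RatClass k)) (show g u = 0 from hu)
  exact sq_eq_one_of_mem_ratUnits k ((RatClass.mk_eq_one_iff k).mp h1)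

/-- Both sides are `ℚˣ · 𝓞ˣ` inside `kˣ`. This converts statements about `kˣ / ℚˣ` into statements
about principal ideals. -/
theorem comap_mk_range_unitsModRat :
    (unitsModRat k).range.comap (RatClass.mk k) =
      (ratIdeals k).comap (toPrincipalIdeal (𝓞 k) k) := by
  rw [unitsModRat, MonoidHom.range_comp, Subgroup.comap_map_eq, RatClass.ker_mk, ratIdeals,
    Subgroup.comap_map_eq, sup_comm]
  congr 1
  ext x
  exact (toPrincipalIdeal_eq_one_iff k).symm

/-- The group of principal ideals with rational square is measured by the units which are rational
multiples of squares. -/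
theorem relIndex_ratIdeals_mul_index_ratSqUnits
    [Finite (powMonoidHom 2 : RatClass k →* _).ker] :
    (ratIdeals k).relIndex (sqrtRatIdeals k ⊓ (toPrincipalIdeal (𝓞 k) k).range) *
        (ratSqUnits k).index =
      2 ^ Units.rank k * Nat.card (powMonoidHom 2 : RatClass k →* _).ker := by
  set A := RatClass k
  set U : Subgroup A := (unitsModRat k).range with hU
  set T : Subgroup A := U.comap (powMonoidHom 2) with hT
  have hfin : Module.Finite ℤ U.toAddSubgroup :=
    Module.Finite.of_surjective
      ((MonoidHom.toAdditive (unitsModRat k).rangeRestrict).toIntLinearMap)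
      (unitsModRat k).rangeRestrict_surjective
  have hker : Finite (nsmulAddMonoidHom (α := Additive A) 2).ker :=
    inferInstanceAs (Finite (powMonoidHom 2 : A →* A).ker)
  have key : U.relIndex T * (T.map (powMonoidHom 2)).relIndex U =
      2 ^ Module.finrank ℤ (Additive U) * Nat.card (powMonoidHom 2 : A →* A).ker :=
    AddSubgroup.relIndex_comap_two_nsmul_mul U.toAddSubgroup
  rw [hU, finrank_range_unitsModRat, ← hU] at key
  rw [← key]
  congr 1
  -- Both indices are computed in `kˣ`: `x²` lies in `ℚˣ · 𝓞ˣ` exactly when the square of the ideal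
  -- `(x)` is rational.
  · rw [inf_comm, ← Subgroup.map_comap_eq, ← Subgroup.relIndex_comap,
      ← comap_mk_range_unitsModRat,
      ← Subgroup.map_comap_eq_self_of_surjective (RatClass.mk_surjective k) T,
      ← Subgroup.relIndex_comap]
    congr 1
    rw [sqrtRatIdeals, hT, Subgroup.comap_comap, Subgroup.comap_comap]
    have h1 : (powMonoidHom 2).comp (toPrincipalIdeal (𝓞 k) k) =
        (toPrincipalIdeal (𝓞 k) k).comp (powMonoidHom 2) := by ext; simp
    have h2 : (powMonoidHom 2).comp (RatClass.mk k) =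
        (RatClass.mk k).comp (powMonoidHom 2) := by ext; simp
    rw [h1, h2, ← Subgroup.comap_comap, ← Subgroup.comap_comap, comap_mk_range_unitsModRat]
  -- Pulled back to the units, `T²` becomes the set of `u = r α²`; the class of `α` is automatically
  -- in `T`.
  · rw [hU, MonoidHom.range_eq_map, ← Subgroup.relIndex_comap, Subgroup.relIndex_top_right]
    congr 1
    ext u
    rw [Subgroup.mem_comap, ratSqUnits, Subgroup.mem_comap, Subgroup.mem_sup]
    constructor
    · rintro ⟨r, hr, _, ⟨α, rfl⟩, h⟩
      have h' : unitsModRat k u = RatClass.mk k α ^ 2 := by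
        change RatClass.mk k _ = _
        rw [← h, map_mul, (RatClass.mk_eq_one_iff k).mpr hr, one_mul]
        exact map_pow _ α 2
      refine ⟨RatClass.mk k α, ?_, h'.symm⟩
      exact ⟨u, h'⟩
    · rintro ⟨a, -, ha⟩
      obtain ⟨α, rfl⟩ := RatClass.mk_surjective k a
      have ha : RatClass.mk k (α ^ 2) = RatClass.mk k
        (Units.map (algebraMap (𝓞 k) k).toMonoidHom u) := (map_pow _ α 2).trans ha
      obtain ⟨z, hz, h⟩ : ∃ z ∈ ratUnits k, α ^ 2 * z =
          Units.map (algebraMap (𝓞 k) k).toMonoidHom u :=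
        ⟨_, (RatClass.mk_eq_one_iff k).mp (by rw [map_mul, map_inv, ha, inv_mul_cancel]),
          mul_inv_cancel_left _ _⟩
      exact ⟨z, hz, α ^ 2, ⟨α, rfl⟩, by rw [mul_comm, h]⟩

end

/-! ### Elements with rational square and quadratic characters -/

section

variable (k : Type*) [Field k] [NumberField k]

/-- Every rational character of the Galois group is `σ ↦ σ β / β` for some `β`. -/
theorem exists_forall_apply_eq_character_mul [IsGalois ℚ k] (χ : Gal(k/ℚ) →* ℚˣ) :
    ∃ β : kˣ, ∀ σ : Gal(k/ℚ), σ (β : k) = ((χ σ : ℚ) : k) * β := by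
  obtain ⟨β, hβ⟩ := groupCohomology.isMulCoboundary₁_of_isMulCocycle₁_of_aut_to_units
    (fun σ : Gal(k/ℚ) => Units.map (algebraMap ℚ k).toMonoidHom (χ σ)) (fun σ τ => by
      ext
      simp [mul_comm])
  refine ⟨β, fun σ => ?_⟩
  have h := congrArg Units.val (div_eq_iff_eq_mul.mp (hβ σ))
  simpa using h

variable {k}

/-- The quadratic character attached to an element with rational square. -/
theorem exists_character_of_sq_mem {α : kˣ} (hα : α ^ 2 ∈ ratUnits k) :
    ∃ χ : Gal(k/ℚ) →* ℚˣ, ∀ σ : Gal(k/ℚ), σ (α : k) = ((χ σ : ℚ) : k) * α := by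
  classical
  obtain ⟨r, hr⟩ := (mem_ratUnits k).mp hα
  rw [Units.val_pow_eq_pow_val] at hr
  have hα0 : (α : k) ≠ 0 := α.ne_zero
  have hsign : ∀ σ : Gal(k/ℚ), σ (α : k) = α ∨ σ (α : k) = -α := fun σ => by
    rw [← sq_eq_sq_iff_eq_or_eq_neg, ← map_pow, hr, map_ratCast]
  have hne : -(α : k) ≠ α := fun h => hα0 (self_eq_neg.mp h.symm)
  let χ : Gal(k/ℚ) → ℚˣ := fun σ => if σ (α : k) = α then 1 else -1
  have hχ : ∀ σ : Gal(k/ℚ), σ (α : k) = ((χ σ : ℚ) : k) * α := fun σ => by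
    rcases hsign σ with h | h <;> simp [χ, h, hne]
  refine ⟨{ toFun := χ, map_one' := by simp [χ], map_mul' := fun σ τ => ?_ }, hχ⟩
  have h1 := hχ (σ * τ)
  rw [AlgEquiv.mul_apply, hχ τ, map_mul, map_ratCast, hχ σ, ← mul_assoc] at h1
  have h2 := mul_right_cancel₀ hα0 h1
  ext
  rw [Units.val_mul, mul_comm]
  exact_mod_cast h2.symm

variable (k)

/-- Kummer theory: `α` with `α² ∈ ℚ` gives the character `σ ↦ σ α / α`, Hilbert 90 inverts this, and
`±1` are enough roots of unity for a group of exponent 2 to have as many characters as elements. -/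
theorem card_ker_sq_ratClass [IsGalois ℚ k] (hexp : Monoid.exponent Gal(k/ℚ) = 2) :
    Nat.card (powMonoidHom 2 : RatClass k →* _).ker = Nat.card Gal(k/ℚ) := by
  let _ : CommGroup Gal(k/ℚ) :=
    { mul_comm := mul_comm_of_exponent_two hexp }
  have hroots : HasEnoughRootsOfUnity ℚ (Monoid.exponent Gal(k/ℚ)) := by
    rw [hexp]
    exact ⟨⟨-1, IsPrimitiveRoot.neg_one 0 (by norm_num)⟩, inferInstance⟩
  rw [← CommGroup.card_monoidHom_of_hasEnoughRootsOfUnity Gal(k/ℚ) ℚ]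
  choose β hβ using exists_forall_apply_eq_character_mul k
  have hmem : ∀ χ, RatClass.mk k (β χ) ∈ (powMonoidHom 2 : RatClass k →* _).ker := fun χ => by
    rw [MonoidHom.mem_ker, powMonoidHom_apply, ← map_pow, RatClass.mk_eq_one_iff, mem_ratUnits]
    have hfix : ((β χ : k) ^ 2) ∈ (⊥ : IntermediateField ℚ k) := by
      rw [IsGalois.mem_bot_iff_fixed]
      intro σ
      have h1 : χ σ ^ 2 = 1 := by rw [← map_pow, ← hexp, Monoid.pow_exponent_eq_one, map_one]
      have h2 : ((χ σ : ℚ) : k) ^ 2 = 1 := by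
        simpa using congrArg (fun x : ℚˣ => ((x : ℚ) : k)) h1
      rw [map_pow, hβ, mul_pow, h2, one_mul]
    obtain ⟨r, hr⟩ := IntermediateField.mem_bot.mp hfix
    exact ⟨r, by rw [Units.val_pow_eq_pow_val, ← hr]; rfl⟩
  symm
  refine Nat.card_congr (Equiv.ofBijective
    (fun χ => (⟨_, hmem χ⟩ : (powMonoidHom 2 : RatClass k →* _).ker)) ⟨fun χ χ' h => ?_, ?_⟩)
  · have h1 : RatClass.mk k (β χ / β χ') = 1 := by
      rw [map_div, div_eq_one]
      exact congrArg Subtype.val h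
    obtain ⟨r, hr⟩ := (mem_ratUnits k).mp ((RatClass.mk_eq_one_iff k).mp h1)
    have h2 : (β χ : k) = r * β χ' := by
      rw [← hr, Units.val_div_eq_div_val, div_mul_cancel₀ _ (Units.ne_zero _)]
    have hr0 : (r : k) ≠ 0 := by rw [← hr]; exact Units.ne_zero _
    ext σ
    have h3 := hβ χ σ
    rw [h2, map_mul, map_ratCast, hβ χ' σ, mul_left_comm] at h3
    have h4 := mul_right_cancel₀ (Units.ne_zero _) (mul_left_cancel₀ hr0
      ((mul_left_comm _ _ _).symm.trans (h3.trans (mul_left_comm _ _ _))))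
    exact_mod_cast h4.symm
  · rintro ⟨a, ha⟩
    obtain ⟨α, rfl⟩ := RatClass.mk_surjective k a
    rw [MonoidHom.mem_ker, powMonoidHom_apply, ← map_pow, RatClass.mk_eq_one_iff] at ha
    obtain ⟨χ, hχ⟩ := exists_character_of_sq_mem ha
    refine ⟨χ, Subtype.ext ?_⟩
    change RatClass.mk k (β χ) = RatClass.mk k α
    rw [← div_eq_one, ← map_div, RatClass.mk_eq_one_iff, mem_ratUnits]
    have hfix : ((β χ : k) / α) ∈ (⊥ : IntermediateField ℚ k) := by
      rw [IsGalois.mem_bot_iff_fixed]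
      intro σ
      have h0 : ((χ σ : ℚ) : k) ≠ 0 := by exact_mod_cast (χ σ).ne_zero
      rw [map_div₀, hβ, hχ, mul_div_mul_left _ _ h0]
    obtain ⟨r, hr⟩ := IntermediateField.mem_bot.mp hfix
    exact ⟨r, by rw [Units.val_div_eq_div_val, ← hr]; rfl⟩

end

/-! ### Norms of units in quadratic fields -/

section

variable (k : Type*) [Field k] [NumberField k]

/-- The norm of a unit, as a sign. -/
def unitNorm : (𝓞 k)ˣ →* ℤˣ := Units.map (Algebra.norm ℤ)

variable {k}

theorem coe_unitNorm (u : (𝓞 k)ˣ) : ((unitNorm k u : ℤ) : ℚ) = Algebra.norm ℚ (u : k) :=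
  Algebra.coe_norm_int (u : 𝓞 k)

theorem unitNorm_eq_one_iff (u : (𝓞 k)ˣ) : unitNorm k u = 1 ↔ Algebra.norm ℚ (u : k) = 1 := by
  rw [← coe_unitNorm, Int.cast_eq_one]
  exact Units.val_eq_one.symm

theorem unitNorm_eq_one_of_pos {u : (𝓞 k)ˣ} (h : 0 < Algebra.norm ℚ (u : k)) :
    unitNorm k u = 1 := by
  rcases Int.units_eq_one_or (unitNorm k u) with h1 | h1
  · exact h1
  · rw [← coe_unitNorm, h1] at h
    norm_num at h

theorem unitNorm_eq_neg_one_iff (u : (𝓞 k)ˣ) :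
    unitNorm k u = -1 ↔ Algebra.norm ℚ (u : k) = -1 := by
  rw [← coe_unitNorm, Units.ext_iff, ← Int.cast_inj (α := ℚ)]
  simp

/-- The nontrivial automorphism of a quadratic field. -/
theorem exists_conj_of_finrank_eq_two (hk : Module.finrank ℚ k = 2) :
    IsGalois ℚ k ∧ Monoid.exponent Gal(k/ℚ) = 2 ∧ Nat.card Gal(k/ℚ) = 2 ∧ ∃ τ : Gal(k/ℚ),
      (∀ σ, σ ≠ 1 → σ = τ) ∧ (∀ x, τ (τ x) = x) ∧
        ∀ x : k, algebraMap ℚ k (Algebra.norm ℚ x) = x * τ x := by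
  have : Algebra.IsQuadraticExtension ℚ k := ⟨hk⟩
  have hgal : IsGalois ℚ k := inferInstance
  have hcard : Nat.card Gal(k/ℚ) = 2 := by rw [IsGalois.card_aut_eq_finrank, hk]
  have : Fact (Nat.Prime 2) := ⟨Nat.prime_two⟩
  obtain ⟨τ, hτ, hτ'⟩ : ∃ τ : Gal(k/ℚ), τ ≠ 1 ∧ ∀ σ, σ = 1 ∨ σ = τ := by
    obtain ⟨x, y, hxy, h⟩ := Nat.card_eq_two_iff.mp hcard
    have h' : ∀ z, z = x ∨ z = y := fun z => by
      have : z ∈ ({x, y} : Set _) := h ▸ Set.mem_univ z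
      simpa using this
    rcases h' 1 with h1 | h1
    · exact ⟨y, by rw [h1]; exact hxy.symm, fun z => by rw [h1]; exact h' z⟩
    · exact ⟨x, by rw [h1]; exact hxy, fun z => by rw [h1]; exact (h' z).symm⟩
  refine ⟨hgal, ?_, hcard, τ, fun σ h => (hτ' σ).resolve_left h, fun x => ?_, fun x => ?_⟩
  · have hcyc : IsCyclic Gal(k/ℚ) := isCyclic_of_prime_card hcard
    rw [IsCyclic.exponent_eq_card, hcard]
  · have h2 : τ * τ = 1 := by
      rw [← pow_two, ← hcard]
      exact pow_card_eq_one'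
    rw [← AlgEquiv.mul_apply, h2, AlgEquiv.one_apply]
  · classical
    rw [Algebra.norm_eq_prod_automorphisms]
    have huniv : (Finset.univ : Finset Gal(k/ℚ)) = {1, τ} := by
      ext σ
      simpa using hτ' σ
    rw [huniv, Finset.prod_pair hτ.symm, AlgEquiv.one_apply]

/-- In a quadratic field, the units that are rational multiples of squares are the units of
norm `1`. -/
theorem ratSqUnits_eq_ker_unitNorm (hk : Module.finrank ℚ k = 2) :
    ratSqUnits k = (unitNorm k).ker := by
  obtain ⟨-, -, -, τ, -, hττ, hτ⟩ := exists_conj_of_finrank_eq_two hk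
  ext u
  rw [mem_ratSqUnits, MonoidHom.mem_ker]
  have h0 : (u : k) ≠ 0 := coe_ne_zero u
  constructor
  · rintro ⟨r, α, h⟩
    refine unitNorm_eq_one_of_pos (lt_of_le_of_ne ?_ (Algebra.norm_ne_zero_iff.mpr h0).symm)
    rw [h, map_mul, map_pow, show ((r : k)) = algebraMap ℚ k r from rfl,
      Algebra.norm_algebraMap, hk]
    positivity
  · intro h
    have h1 : (u : k) * τ u = 1 := by rw [← hτ, (unitNorm_eq_one_iff u).mp h, map_one]
    -- Explicit Hilbert 90: `u τ(u) = 1` gives `u (1 + τ u) = 1 + u`, so `u = (1 + u)² / N(1 + u)`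
    -- unless `u = -1`.
    by_cases hu : (1 : k) + u = 0
    · exact ⟨-1, 1, by push_cast; linear_combination hu⟩
    · refine ⟨(Algebra.norm ℚ (1 + (u : k)))⁻¹, 1 + u, ?_⟩
      have h2 : ((Algebra.norm ℚ (1 + (u : k)) : ℚ) : k) = (1 + u) * (1 + τ u) := by
        rw [← map_one τ, ← map_add, map_one τ]
        exact hτ (1 + (u : k))
      have h3 : (1 : k) + τ u ≠ 0 := by
        rw [← map_one τ, ← map_add]
        exact (map_ne_zero τ).mpr hu
      rw [Rat.cast_inv, h2]
      field_simp
      linear_combination h1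

end

/-! ### The Klein four-group and the three quadratic subfields -/

section

variable {K : Type*} [Field K] [NumberField K]

/-- The nontrivial automorphisms `σ i` of `K` are numbered so that `k i` is the fixed field of
`σ i`. -/
structure IsConjSystem (k : Fin 3 → IntermediateField ℚ K) (σ : Fin 3 → Gal(K/ℚ)) : Prop where
  fields_injective : Function.Injective k
  injective : Function.Injective σ
  ne_one : ∀ i, σ i ≠ 1
  apply_eq_iff : ∀ i x, σ i x = x ↔ x ∈ k i
  eq_of_ne_one : ∀ g : Gal(K/ℚ), g ≠ 1 → ∃ i, g = σ i

theorem exists_isConjSystem [IsGalois ℚ K] (hK : IsKleinFour Gal(K/ℚ))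
    (k : Fin 3 → IntermediateField ℚ K) (hk_inj : Function.Injective k)
    (hk_deg : ∀ i, Module.finrank ℚ (k i) = 2) : ∃ σ, IsConjSystem k σ := by
  have hKdeg : Module.finrank ℚ K = 4 := by rw [← IsGalois.card_aut_eq_finrank, hK.card_four]
  have hcard : ∀ i, Nat.card (k i).fixingSubgroup = 2 := fun i => by
    rw [IsGalois.card_fixingSubgroup_eq_finrank]
    have := Module.finrank_mul_finrank ℚ (k i) K
    rw [hk_deg, hKdeg] at this
    omega
  have hex : ∀ i, ∃ σ : Gal(K/ℚ), σ ≠ 1 ∧ ((k i).fixingSubgroup : Set _) = {1, σ} := fun i => by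
    have hlt : 1 < Nat.card (k i).fixingSubgroup := by rw [hcard i]; norm_num
    have := Finite.one_lt_card_iff_nontrivial.mp hlt
    obtain ⟨⟨σ, hσ⟩, hne⟩ := exists_ne (1 : (k i).fixingSubgroup)
    have hne' : σ ≠ 1 := fun h => hne (Subtype.ext h)
    refine ⟨σ, hne', (Set.eq_of_subset_of_ncard_le ?_ ?_ (Set.toFinite _)).symm⟩
    · rintro x (rfl | rfl)
      exacts [one_mem _, hσ]
    · rw [Set.ncard_pair hne'.symm]
      exact (hcard i).le
  choose σ hσ1 hσ using hex
  have hfix : ∀ i x, σ i x = x ↔ x ∈ k i := fun i x => by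
    conv_rhs => rw [← IsGalois.fixedField_fixingSubgroup (k i)]
    rw [IntermediateField.mem_fixedField_iff]
    have hmem : ∀ f, f ∈ (k i).fixingSubgroup ↔ f = 1 ∨ f = σ i := fun f => by
      rw [← SetLike.mem_coe, hσ i]
      simp
    simp [hmem]
  have hinj : Function.Injective σ := fun i j h => by
    apply hk_inj
    ext x
    rw [← hfix, ← hfix, h]
  refine ⟨σ, hk_inj, hinj, hσ1, hfix, fun g hg => ?_⟩
  classical
  have hcard' : (Finset.univ.image σ ∪ {1}).card = Fintype.card Gal(K/ℚ) := by
    rw [Finset.card_union_of_disjoint, Finset.card_image_of_injective _ hinj,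
      ← Nat.card_eq_fintype_card, hK.card_four]
    · simp
    · simpa using fun i => hσ1 i
  have := (Finset.card_eq_iff_eq_univ _).mp hcard'
  have hg' : g ∈ Finset.univ.image σ ∪ {1} := this ▸ Finset.mem_univ g
  simp only [Finset.mem_union, Finset.mem_image, Finset.mem_univ, true_and,
    Finset.mem_singleton, hg, or_false] at hg'
  obtain ⟨i, rfl⟩ := hg'
  exact ⟨i, rfl⟩

namespace IsConjSystem

variable {k : Fin 3 → IntermediateField ℚ K} {σ : Fin 3 → Gal(K/ℚ)}

theorem apply_apply (_ : IsConjSystem k σ) (hK : IsKleinFour Gal(K/ℚ)) (i : Fin 3) (x : K) :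
    σ i (σ i x) = x := by
  rw [← AlgEquiv.mul_apply, IsKleinFour.mul_self, AlgEquiv.one_apply]

theorem apply_apply_of_ne (hσ : IsConjSystem k σ) (hK : IsKleinFour Gal(K/ℚ)) {i j l : Fin 3}
    (hij : i ≠ j) (hli : l ≠ i) (hlj : l ≠ j) (x : K) : σ i (σ j x) = σ l x := by
  rw [← AlgEquiv.mul_apply, IsKleinFour.eq_mul_of_ne_all (hσ.ne_one i) (hσ.ne_one j)
    (hσ.injective.ne hij) (hσ.ne_one l) (hσ.injective.ne hli) (hσ.injective.ne hlj)]

theorem norm_eq [IsGalois ℚ K] (hσ : IsConjSystem k σ) (x : K) :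
    ((Algebra.norm ℚ x : ℚ) : K) = x * σ 0 x * σ 1 x * σ 2 x := by
  classical
  have := Algebra.norm_eq_prod_automorphisms ℚ x
  have huniv : (Finset.univ : Finset Gal(K/ℚ)) = insert 1 (Finset.univ.image σ) := by
    ext g
    by_cases hg : g = 1
    · simp [hg]
    · obtain ⟨i, rfl⟩ := hσ.eq_of_ne_one g hg
      simp
  rw [huniv, Finset.prod_insert (by simpa using fun i => hσ.ne_one i),
    Finset.prod_image (fun i _ j _ h => hσ.injective h), Fin.prod_univ_three] at this
  rw [← eq_ratCast (algebraMap ℚ K), this, AlgEquiv.one_apply]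
  ring

/-- For `j ≠ i` the fixed field of `σ j` is not `k i`, so `σ j` restricts to the nontrivial
automorphism of `k i`. -/
theorem norm_subfield_eq (hσ : IsConjSystem k σ)
    (hk_deg : ∀ i, Module.finrank ℚ (k i) = 2) {i j : Fin 3} (hij : j ≠ i) (x : k i) :
    ((Algebra.norm ℚ x : ℚ) : K) = x * σ j x := by
  obtain ⟨hgal, -, -, τ, hτ, -, hnorm⟩ := exists_conj_of_finrank_eq_two (hk_deg i)
  have hres : (σ j).restrictNormal (k i) = τ := by
    refine hτ _ fun h => hσ.fields_injective.ne hij.symm ?_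
    have hfix : ∀ y ∈ k i, σ j y = y := fun y hy => by
      have h1 := (σ j).restrictNormal_commutes (k i) ⟨y, hy⟩
      rw [h] at h1
      exact h1.symm
    exact IntermediateField.eq_of_le_of_finrank_eq
      (fun y hy => (hσ.apply_eq_iff j y).mp (hfix y hy)) (by rw [hk_deg, hk_deg])
  have h1 := congrArg (algebraMap (k i) K) (hnorm x)
  rw [map_mul, ← hres, AlgEquiv.restrictNormal_commutes, ← IsScalarTower.algebraMap_apply,
    eq_ratCast] at h1
  exact h1

end IsConjSystem

end

/-! ### Units of `K` against products of units of the subfields -/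

section

variable {K : Type*} [Field K] [NumberField K] (k : Fin 3 → IntermediateField ℚ K)

/-- The product map `𝓞 k₁ˣ × 𝓞 k₂ˣ × 𝓞 k₃ˣ → 𝓞 Kˣ`. -/
def unitsProd : (∀ i, (𝓞 (k i))ˣ) →* (𝓞 K)ˣ :=
  ∏ i, (Units.map (algebraMap (𝓞 (k i)) (𝓞 K)).toMonoidHom).comp
    (Pi.evalMonoidHom (fun i => (𝓞 (k i))ˣ) i)

/-- The signs of the norms of a triple of units. -/
def unitSigns : (∀ i, (𝓞 (k i))ˣ) →* (Fin 3 → ℤˣ) :=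
  MonoidHom.pi fun i => (unitNorm (k i)).comp (Pi.evalMonoidHom (fun i => (𝓞 (k i))ˣ) i)

theorem unitsProd_apply (u : ∀ i, (𝓞 (k i))ˣ) :
    unitsProd k u = ∏ i, Units.map (algebraMap (𝓞 (k i)) (𝓞 K)).toMonoidHom (u i) := by
  simp [unitsProd, MonoidHom.finsetProd_apply]

theorem coe_unitsProd (u : ∀ i, (𝓞 (k i))ˣ) :
    (unitsProd k u : K) = ∏ i, ((u i : k i) : K) := by
  rw [unitsProd_apply, Units.coe_prod, map_prod]
  rfl

theorem range_unitsProd :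
    (unitsProd k).range = ⨆ i, (Units.map (algebraMap (𝓞 (k i)) (𝓞 K)).toMonoidHom).range := by
  apply le_antisymm
  · rintro _ ⟨u, rfl⟩
    rw [unitsProd_apply]
    exact Subgroup.prod_mem _ fun i _ => Subgroup.mem_iSup_of_mem i ⟨u i, rfl⟩
  · refine iSup_le fun i => ?_
    rintro _ ⟨u, rfl⟩
    refine ⟨Pi.mulSingle i u, ?_⟩
    rw [unitsProd_apply, Finset.prod_eq_single i]
    · rw [Pi.mulSingle_eq_same]
    · intro j _ hj
      rw [Pi.mulSingle_eq_of_ne hj, map_one]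
    · simp

theorem Fin.prod_univ_three_of_ne {M : Type*} [CommMonoid M] (f : Fin 3 → M) {i j l : Fin 3}
    (hij : i ≠ j) (hli : l ≠ i) (hlj : l ≠ j) : ∏ x, f x = f i * f j * f l := by
  have : (Finset.univ : Finset (Fin 3)) = {i, j, l} := by
    revert i j l; decide
  rw [this, Finset.prod_insert (by simp [hij, hli.symm]), Finset.prod_pair hlj.symm, mul_assoc]

variable {k}

/-- An element of a subfield is a unit there if it is the square root of a unit. -/
theorem exists_unit_of_isIntegral_sq {F : IntermediateField ℚ K} {x : K} (hx0 : x ≠ 0)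
    (hx : x ∈ F) (h1 : IsIntegral ℤ (x ^ 2)) (h2 : IsIntegral ℤ (x⁻¹ ^ 2)) :
    ∃ u : (𝓞 F)ˣ, ((u : F) : K) = x := by
  have hi : ∀ y : F, IsIntegral ℤ ((y : K) ^ 2) → IsIntegral ℤ y := fun y hy =>
    (isIntegral_algebraMap_iff (algebraMap F K).injective).mp (IsIntegral.of_pow two_pos hy)
  let y : F := ⟨x, hx⟩
  have hy0 : y ≠ 0 := fun h => hx0 (congrArg Subtype.val h)
  exact ⟨⟨⟨y, hi y h1⟩, ⟨y⁻¹, hi y⁻¹ h2⟩, RingOfIntegers.ext (mul_inv_cancel₀ hy0),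
    RingOfIntegers.ext (inv_mul_cancel₀ hy0)⟩, rfl⟩

variable {σ : Fin 3 → Gal(K/ℚ)}

/-- For `u = r α²` put `w_i = r α σ_i(α)`. It is fixed by `σ_i`, and `w_i² = u σ_i(u)` makes it a
unit of `k i`. The product of the `w_i` is `r² N(α) u`; a rational unit is `±1`, and a sign can be
absorbed in one factor. -/
theorem ratSqUnits_le_range_unitsProd [IsGalois ℚ K] (hK : IsKleinFour Gal(K/ℚ))
    (hσ : IsConjSystem k σ) : ratSqUnits K ≤ (unitsProd k).range := by
  intro u hu
  obtain ⟨r, α, h⟩ := (mem_ratSqUnits K).mp hu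
  have hu0 : (u : K) ≠ 0 := coe_ne_zero u
  have hr : (r : K) ≠ 0 := by intro hr; simp [hr] at h
  have hα : α ≠ 0 := by rintro rfl; simp at h
  have hw : ∀ i, ∃ w : (𝓞 (k i))ˣ, ((w : k i) : K) = r * (α * σ i α) := fun i => by
    have hsq : (r * (α * σ i α)) ^ 2 = (u : K) * σ i u := by
      rw [h, map_mul, map_pow, map_ratCast]; ring
    have hint : IsIntegral ℤ (u : K) := RingOfIntegers.isIntegral_coe _
    have hint' : IsIntegral ℤ ((u : K)⁻¹) := by
      have : ((u⁻¹ : (𝓞 K)ˣ) : K) = (u : K)⁻¹ := by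
        refine eq_inv_of_mul_eq_one_left ?_
        rw [← coe_mul, inv_mul_cancel, coe_one]
      rw [← this]
      exact RingOfIntegers.isIntegral_coe _
    refine exists_unit_of_isIntegral_sq ?_ ?_ ?_ ?_
    · exact mul_ne_zero hr (mul_ne_zero hα ((map_ne_zero _).mpr hα))
    · rw [← hσ.apply_eq_iff, map_mul, map_mul, hσ.apply_apply hK, map_ratCast]
      ring
    · rw [hsq]
      exact hint.mul (hint.map (σ i).toRingEquiv.toRingHom.toIntAlgHom)
    · rw [inv_pow, hsq, mul_inv, ← map_inv₀ (σ i)]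
      exact hint'.mul (hint'.map (σ i).toRingEquiv.toRingHom.toIntAlgHom)
  choose w hw using hw
  have hprod : (unitsProd k w : K) = ((r ^ 2 * Algebra.norm ℚ α : ℚ) : K) * u := by
    rw [coe_unitsProd, Fin.prod_univ_three, hw, hw, hw, h]
    push_cast
    rw [hσ.norm_eq]
    ring
  have hmem : unitsProd k w * u⁻¹ ∈ (ratUnits K).comap
      (Units.map (algebraMap (𝓞 K) K).toMonoidHom) := by
    refine (mem_ratUnits K).mpr ⟨r ^ 2 * Algebra.norm ℚ α, ?_⟩
    refine mul_right_cancel₀ hu0 ?_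
    rw [← hprod]
    change ((unitsProd k w * u⁻¹ : (𝓞 K)ˣ) : K) * (u : K) = _
    rw [← coe_mul, inv_mul_cancel_right]
  have hsq := sq_eq_one_of_mem_ratUnits K hmem
  have hcases : unitsProd k w = u ∨ unitsProd k w = -u := by
    rw [mul_pow, inv_pow, mul_inv_eq_one, Units.ext_iff, Units.val_pow_eq_pow_val,
      Units.val_pow_eq_pow_val, sq_eq_sq_iff_eq_or_eq_neg] at hsq
    exact hsq.imp Units.ext Units.ext
  rcases hcases with h | h
  · exact ⟨w, h⟩
  · refine ⟨w * Pi.mulSingle 0 (-1), ?_⟩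
    have : unitsProd k (Pi.mulSingle 0 (-1)) = -1 := by
      rw [unitsProd_apply, Fin.prod_univ_three]
      simp
    rw [map_mul, h, this, mul_neg_one, neg_neg]

theorem unitSigns_apply (u : ∀ i, (𝓞 (k i))ˣ) (i : Fin 3) :
    unitSigns k u i = unitNorm (k i) (u i) := rfl

/-- A unit of norm 1 in `k i` is a rational multiple of a square there, hence also in `K`. -/
theorem ker_unitSigns_le (hk_deg : ∀ i, Module.finrank ℚ (k i) = 2) :
    (unitSigns k).ker ≤ (ratSqUnits K).comap (unitsProd k) := by
  intro u hu
  rw [Subgroup.mem_comap, unitsProd_apply]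
  refine Subgroup.prod_mem _ fun i _ => ?_
  have h1 : u i ∈ ratSqUnits (k i) := by
    rw [ratSqUnits_eq_ker_unitNorm (hk_deg i), MonoidHom.mem_ker, ← unitSigns_apply,
      (MonoidHom.mem_ker).mp hu]
    rfl
  obtain ⟨r, α, h⟩ := (mem_ratSqUnits _).mp h1
  refine (mem_ratSqUnits _).mpr ⟨r, α, ?_⟩
  have h2 := congrArg (algebraMap (k i) K) h
  rw [map_mul, map_pow, map_ratCast] at h2
  exact h2

/-- The identity `σ(u) u = u_i² N(u_j) N(u_l)` for `u = u_i u_j u_l` and `σ` fixing `u_i`. -/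
theorem unitsProd_mul_conj (hσ : IsConjSystem k σ) (hk_deg : ∀ i, Module.finrank ℚ (k i) = 2)
    (u : ∀ i, (𝓞 (k i))ˣ) {i j l : Fin 3} (hij : i ≠ j) (hli : l ≠ i) (hlj : l ≠ j) :
    (unitsProd k u : K) * σ i (unitsProd k u : K) =
      ((u i : k i) : K) ^ 2 * ((unitNorm _ (u j) : ℤ) : K) * ((unitNorm _ (u l) : ℤ) : K) := by
  have hn : ∀ m, i ≠ m → (((u m : k m) : K)) * σ i ((u m : k m) : K) =
      ((unitNorm _ (u m) : ℤ) : K) := fun m hm => by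
    rw [← hσ.norm_subfield_eq hk_deg hm, ← coe_unitNorm]
    norm_cast
  rw [coe_unitsProd, Fin.prod_univ_three_of_ne _ hij hli hlj, map_mul, map_mul,
    (hσ.apply_eq_iff i _).mpr (u i : k i).2, ← hn j hij, ← hn l hli.symm]
  ring

/-- If the product `u` is `r α²`, then `u σ_i(u) = (r α σ_i(α))²` is nonnegative in `ℝ`. It also
equals `u_i² N(u_j) N(u_l)`, so the two norms have the same sign. -/
theorem unitNorm_eq_of_unitsProd_mem (hσ : IsConjSystem k σ)
    (hk_deg : ∀ i, Module.finrank ℚ (k i) = 2) (φ : K →+* ℝ) {u : ∀ i, (𝓞 (k i))ˣ}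
    (hu : unitsProd k u ∈ ratSqUnits K) (j l : Fin 3) :
    unitNorm (k j) (u j) = unitNorm (k l) (u l) := by
  by_cases hjl : l = j
  · subst hjl; rfl
  obtain ⟨i, hij, hli⟩ : ∃ i : Fin 3, i ≠ j ∧ l ≠ i := by
    revert j l; decide
  obtain ⟨r, α, h⟩ := (mem_ratSqUnits _).mp hu
  have h1 := unitsProd_mul_conj hσ hk_deg u hij hli hjl
  rw [h, map_mul, map_pow, map_ratCast] at h1
  have h2 := congrArg φ h1
  simp only [map_mul, map_pow, map_ratCast, map_intCast] at h2
  have h3 : φ ((u i : k i) : K) ≠ 0 :=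
    (map_ne_zero φ).mpr fun h => coe_ne_zero (u i) (Subtype.ext h)
  have h4 : 0 < φ ((u i : k i) : K) ^ 2 := by positivity
  rcases Int.units_eq_one_or (unitNorm _ (u j)) with hj | hj <;>
  rcases Int.units_eq_one_or (unitNorm _ (u l)) with hl | hl <;>
  rw [hj, hl] at h2 ⊢ <;> exfalso <;> push_cast at h2 <;>
  nlinarith [sq_nonneg (r * φ α * φ (σ i α))]

/-- Let `β = a + b + c - abc`, where `a`, `b`, `c` are the three units. The automorphism fixing `a`
sends `b`, `c` to `-1/b`, `-1/c`; it multiplies `β` by `s = -(bc)⁻¹` and `abc` by `s²`. By symmetry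
`abc / β²` is fixed by all of the Galois group, hence rational. -/
theorem unitsProd_mem_of_forall_unitNorm_eq_neg_one [IsGalois ℚ K] (hσ : IsConjSystem k σ)
    (hk_deg : ∀ i, Module.finrank ℚ (k i) = 2) (φ : K →+* ℝ) {u : ∀ i, (𝓞 (k i))ˣ}
    (hu : ∀ i, unitNorm (k i) (u i) = -1) : unitsProd k u ∈ ratSqUnits K := by
  have key : ∀ a b c : K, (σ 0 a = a ∧ a * σ 1 a = -1 ∧ a * σ 2 a = -1) →
      (σ 1 b = b ∧ b * σ 0 b = -1 ∧ b * σ 2 b = -1) →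
      (σ 2 c = c ∧ c * σ 0 c = -1 ∧ c * σ 1 c = -1) → a + b + c - a * b * c ≠ 0 →
      ∃ r : ℚ, a * b * c = r * (a + b + c - a * b * c) ^ 2 := by
    rintro a b c ⟨a0, a1, a2⟩ ⟨b1, b0, b2⟩ ⟨c2, c0, c1⟩ hβ
    have hne : ∀ {x y : K}, x * y = -1 → x ≠ 0 ∧ y = -x⁻¹ := fun {x y} h => by
      have hx : x ≠ 0 := by rintro rfl; simp at h
      exact ⟨hx, by field_simp; linear_combination h⟩
    obtain ⟨ha, a1⟩ := hne a1
    obtain ⟨-, a2⟩ := hne a2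
    obtain ⟨hb, b0⟩ := hne b0
    obtain ⟨-, b2⟩ := hne b2
    obtain ⟨hc, c0⟩ := hne c0
    obtain ⟨-, c1⟩ := hne c1
    have hfix : a * b * c / (a + b + c - a * b * c) ^ 2 ∈ (⊥ : IntermediateField ℚ K) := by
      rw [IsGalois.mem_bot_iff_fixed]
      have haux : ∀ g : Gal(K/ℚ), ∀ s : K, s ≠ 0 → g (a * b * c) = a * b * c * s ^ 2 →
          g (a + b + c - a * b * c) = (a + b + c - a * b * c) * s →
          g (a * b * c / (a + b + c - a * b * c) ^ 2) =
            a * b * c / (a + b + c - a * b * c) ^ 2 := fun g s hs h1 h2 => by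
        rw [map_div₀, map_pow, h1, h2]
        field_simp
      intro g
      by_cases hg : g = 1
      · rw [hg, AlgEquiv.one_apply]
      obtain ⟨i, rfl⟩ := hσ.eq_of_ne_one g hg
      fin_cases i
      · refine haux _ (-(b * c)⁻¹) (by simp [hb, hc]) ?_ ?_ <;>
        · simp only [map_add, map_sub, map_mul, Fin.zero_eta, a0, b0, c0]
          field_simp
          try ring
      · refine haux _ (-(a * c)⁻¹) (by simp [ha, hc]) ?_ ?_ <;>
        · simp only [map_add, map_sub, map_mul, Fin.mk_one, a1, b1, c1]
          field_simp
          try ring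
      · refine haux _ (-(a * b)⁻¹) (by simp [ha, hb]) ?_ ?_ <;>
        · simp only [map_add, map_sub, map_mul, Fin.reduceFinMk, a2, b2, c2]
          field_simp
          try ring
    obtain ⟨r, hr⟩ := IntermediateField.mem_bot.mp hfix
    refine ⟨r, ?_⟩
    rw [eq_ratCast] at hr
    rw [hr, div_mul_cancel₀ _ (pow_ne_zero 2 hβ)]
  have hn : ∀ i j : Fin 3, j ≠ i → ((u i : k i) : K) * σ j ((u i : k i) : K) = -1 :=
    fun i j hij => by
      rw [← hσ.norm_subfield_eq hk_deg hij, (unitNorm_eq_neg_one_iff _).mp (hu i)]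
      norm_num
  have hf : ∀ i, σ i ((u i : k i) : K) = ((u i : k i) : K) := fun i =>
    (hσ.apply_eq_iff i _).mpr (u i : k i).2
  rw [mem_ratSqUnits, coe_unitsProd, Fin.prod_univ_three]
  set a : K := ((u 0 : k 0) : K)
  set b : K := ((u 1 : k 1) : K)
  set c : K := ((u 2 : k 2) : K)
  have ha0 : a ≠ 0 := fun h => coe_ne_zero (u 0) (Subtype.ext h)
  have hA := And.intro (hf 0) (And.intro (hn 0 1 (by decide)) (hn 0 2 (by decide)))
  have hB := And.intro (hf 1) (And.intro (hn 1 0 (by decide)) (hn 1 2 (by decide)))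
  have hC := And.intro (hf 2) (And.intro (hn 2 0 (by decide)) (hn 2 1 (by decide)))
  by_cases h1 : a + b + c - a * b * c = 0
  -- If `β = 0`, then `-a` replaces `a`: were the new `β` zero too, then `c = -b` and `a (1 + b²) =
  -- 0`, impossible in `ℝ`.
  · have h2 : -a + b + c - -a * b * c ≠ 0 := by
      intro h2
      have h3 : c = -b := by linear_combination (1 / 2 : K) * h1 + (1 / 2 : K) * h2
      have h4 : a * (1 + b ^ 2) = 0 := by rw [h3] at h1; linear_combination h1
      have h5 : 1 + b ^ 2 = 0 := (mul_eq_zero.mp h4).resolve_left ha0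
      have h6 := congrArg φ h5
      rw [map_add, map_one, map_pow, map_zero] at h6
      nlinarith [sq_nonneg (φ b)]
    obtain ⟨r, hr⟩ := key (-a) b c (by simpa only [map_neg, neg_inj, neg_mul_neg] using hA) hB hC h2
    exact ⟨-r, -a + b + c - -a * b * c, by push_cast; linear_combination -hr⟩
  · obtain ⟨r, hr⟩ := key a b c hA hB hC h1
    exact ⟨r, _, hr⟩

/-- If complex conjugation induces `σ i` on `K`, then the norm of `u` from `k l`, `l ≠ i`, is
positive. -/
theorem unitNorm_eq_one_of_conj (hσ : IsConjSystem k σ)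
    (hk_deg : ∀ i, Module.finrank ℚ (k i) = 2) (φ : K →+* ℂ) {i : Fin 3}
    (hφ : ∀ x, φ (σ i x) = starRingEnd ℂ (φ x)) {l : Fin 3} (hl : l ≠ i) (u : (𝓞 (k l))ˣ) :
    unitNorm (k l) u = 1 := by
  have h0 : ((u : k l) : K) ≠ 0 := fun h => coe_ne_zero u (Subtype.ext h)
  have h1 := congrArg φ (hσ.norm_subfield_eq hk_deg hl.symm (u : k l))
  rw [map_ratCast, map_mul, hφ, Complex.mul_conj] at h1
  refine unitNorm_eq_one_of_pos ?_
  have h2 : 0 < Complex.normSq (φ ((u : k l) : K)) :=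
    Complex.normSq_pos.mpr ((map_ne_zero φ).mpr h0)
  have h3 : ((Algebra.norm ℚ (u : k l) : ℚ) : ℝ) = Complex.normSq (φ ((u : k l) : K)) := by
    exact_mod_cast h1
  rw [← h3] at h2
  exact_mod_cast h2

/-- Two of the norms are positive by `unitNorm_eq_one_of_conj`. For the remaining unit, `u_i² = (r α
σ_i(α))²`, whence `N(u_i) = r² N(α)`; and `N(α)` is a product of two squared absolute values since
`σ i` is complex conjugation. -/
theorem unitSigns_eq_one_of_unitsProd_mem [IsGalois ℚ K] (hK : IsKleinFour Gal(K/ℚ))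
    (hσ : IsConjSystem k σ)
    (hk_deg : ∀ i, Module.finrank ℚ (k i) = 2) (φ : K →+* ℂ) {i : Fin 3}
    (hφ : ∀ x, φ (σ i x) = starRingEnd ℂ (φ x)) {u : ∀ i, (𝓞 (k i))ˣ}
    (hu : unitsProd k u ∈ ratSqUnits K) : unitSigns k u = 1 := by
  have hne : ∀ l, l ≠ i → unitNorm (k l) (u l) = 1 := fun l hl =>
    unitNorm_eq_one_of_conj hσ hk_deg φ hφ hl (u l)
  funext l
  rw [unitSigns_apply, Pi.one_apply]
  by_cases hl : l = i
  swap
  · exact hne l hl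
  subst hl
  obtain ⟨i, j, hij, hli, hlj⟩ : ∃ i j : Fin 3, l ≠ i ∧ j ≠ l ∧ j ≠ i :=
    (by decide : ∀ l : Fin 3, ∃ i j : Fin 3, l ≠ i ∧ j ≠ l ∧ j ≠ i) l
  obtain ⟨r, α, h⟩ := (mem_ratSqUnits _).mp hu
  have h1 := unitsProd_mul_conj hσ hk_deg u hij hli hlj
  rw [hne i hij.symm, hne j hli] at h1
  have hx : ((u l : k l) : K) ^ 2 = (r * (α * σ l α)) ^ 2 := by
    rw [h] at h1
    simp only [map_mul, map_pow, map_ratCast, Units.val_one, Int.cast_one, mul_one] at h1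
    rw [← h1]
    ring
  have h2 : ((Algebra.norm ℚ (u l : k l) : ℚ) : K) = ((r ^ 2 * Algebra.norm ℚ α : ℚ) : K) := by
    have hN : ((Algebra.norm ℚ α : ℚ) : K) = α * σ l α * σ i (α * σ l α) := by
      rw [hσ.norm_eq, map_mul, hσ.apply_apply_of_ne hK hij.symm hlj hli]
      have := Fin.prod_univ_three_of_ne (fun i => σ i α) hij hli hlj
      rw [Fin.prod_univ_three] at this
      linear_combination α * this
    rw [hσ.norm_subfield_eq hk_deg hij.symm]
    push_cast
    rw [hN]
    rcases sq_eq_sq_iff_eq_or_eq_neg.mp hx with hx | hx <;>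
    · rw [hx]
      simp only [map_neg, map_mul, map_ratCast]
      ring
  have h3 : Algebra.norm ℚ (u l : k l) = r ^ 2 * Algebra.norm ℚ α := by exact_mod_cast h2
  have h4 : 0 ≤ Algebra.norm ℚ α := by
    have hN : ((Algebra.norm ℚ α : ℚ) : K) = α * σ l α * (σ i α * σ l (σ i α)) := by
      rw [hσ.norm_eq, hσ.apply_apply_of_ne hK hij hli hlj]
      have := Fin.prod_univ_three_of_ne (fun i => σ i α) hij hli hlj
      rw [Fin.prod_univ_three] at this
      linear_combination α * this
    have h5 := congrArg φ hN
    rw [map_ratCast, map_mul, map_mul, map_mul, hφ, hφ, Complex.mul_conj, Complex.mul_conj] at h5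
    have h6 : ((Algebra.norm ℚ α : ℚ) : ℝ) =
        Complex.normSq (φ α) * Complex.normSq (φ (σ i α)) := by exact_mod_cast h5
    have h7 : (0 : ℝ) ≤ ((Algebra.norm ℚ α : ℚ) : ℝ) := by
      rw [h6]
      exact mul_nonneg (Complex.normSq_nonneg _) (Complex.normSq_nonneg _)
    exact_mod_cast h7
  refine unitNorm_eq_one_of_pos (lt_of_le_of_ne ?_ ?_)
  · rw [h3]
    positivity
  · exact (Algebra.norm_ne_zero_iff.mpr (coe_ne_zero (u l))).symm

end

/-! ### Counting sign vectors -/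

section

variable {K : Type*} [Field K] [NumberField K] {k : Fin 3 → IntermediateField ℚ K}
  {σ : Fin 3 → Gal(K/ℚ)}

theorem card_range_unitSigns (hk_deg : ∀ i, Module.finrank ℚ (k i) = 2) :
    Nat.card (unitSigns k).range = ∏ i, (ratSqUnits (k i)).index := by
  have h1 : ∀ i, (ratSqUnits (k i)).index = Nat.card (unitNorm (k i)).range := fun i => by
    rw [ratSqUnits_eq_ker_unitNorm (hk_deg i), Subgroup.index_ker]
  rw [Finset.prod_congr rfl fun i _ => h1 i, ← Nat.card_pi]
  refine Nat.card_congr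
    { toFun f i := ⟨f.1 i, by obtain ⟨_, u, rfl⟩ := f; exact ⟨u i, rfl⟩⟩
      invFun f := ⟨fun i => (f i).1, by
        choose u hu using fun i => (f i).2
        exact ⟨u, funext hu⟩⟩
      left_inv _ := rfl
      right_inv _ := rfl }

/-- Two chains of indices are compared: in the units of `K`, `ratSqUnits K ≤ range (unitsProd k)`;
in the triples of units, `ker (unitSigns k) ≤ (ratSqUnits K).comap (unitsProd k)`. -/
theorem index_ratSqUnits_mul_card [IsGalois ℚ K] (hK : IsKleinFour Gal(K/ℚ))
    (hσ : IsConjSystem k σ) (hk_deg : ∀ i, Module.finrank ℚ (k i) = 2) :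
    (ratSqUnits K).index *
        Nat.card (((ratSqUnits K).comap (unitsProd k)).map (unitSigns k)) =
      unitIndex k * ∏ i, (ratSqUnits (k i)).index := by
  rw [← card_range_unitSigns hk_deg, ← Subgroup.relIndex_ker, ← Subgroup.index_ker,
    ← Subgroup.relIndex_mul_index (ratSqUnits_le_range_unitsProd hK hσ),
    ← Subgroup.relIndex_mul_index (ker_unitSigns_le hk_deg), unitIndex, ← range_unitsProd,
    MonoidHom.range_eq_map, ← Subgroup.relIndex_comap, Subgroup.relIndex_top_right]
  ring

theorem card_signs_of_real [IsGalois ℚ K] (hσ : IsConjSystem k σ)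
    (hk_deg : ∀ i, Module.finrank ℚ (k i) = 2) (φ : K →+* ℝ) :
    ((∀ i, ∃ u, unitNorm (k i) u = -1) →
      Nat.card (((ratSqUnits K).comap (unitsProd k)).map (unitSigns k)) = 2) ∧
    ((¬ ∀ i, ∃ u, unitNorm (k i) u = -1) →
      Nat.card (((ratSqUnits K).comap (unitsProd k)).map (unitSigns k)) = 1) := by
  refine ⟨fun h => ?_, fun h => ?_⟩
  · choose u hu using h
    have : ((((ratSqUnits K).comap (unitsProd k)).map (unitSigns k) : Subgroup _) :
        Set (Fin 3 → ℤˣ)) =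
        {1, -1} := by
      ext f
      constructor
      · rintro ⟨v, hv, rfl⟩
        have hv' := unitNorm_eq_of_unitsProd_mem hσ hk_deg φ hv
        rcases Int.units_eq_one_or (unitNorm _ (v 0)) with h0 | h0
        · left
          funext i
          exact (hv' i 0).trans h0
        · right
          funext i
          exact (hv' i 0).trans h0
      · rintro (rfl | rfl)
        · exact one_mem _
        · exact ⟨u, unitsProd_mem_of_forall_unitNorm_eq_neg_one hσ hk_deg φ hu, funext hu⟩
    change Nat.card ((((ratSqUnits K).comap (unitsProd k)).map (unitSigns k) : Subgroup _) :
      Set (Fin 3 → ℤˣ)) = 2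
    rw [this, Nat.card_coe_set_eq, Set.ncard_pair]
    exact fun h => by simpa using congrFun h 0
  · rw [Subgroup.card_eq_one, eq_bot_iff]
    rintro _ ⟨v, hv, rfl⟩
    have hv' := unitNorm_eq_of_unitsProd_mem hσ hk_deg φ hv
    funext i
    refine (Int.units_eq_one_or (unitNorm _ (v i))).resolve_right fun hi => h fun j => ?_
    exact ⟨v j, (hv' j i).trans hi⟩

theorem card_signs_of_conj [IsGalois ℚ K] (hK : IsKleinFour Gal(K/ℚ)) (hσ : IsConjSystem k σ)
    (hk_deg : ∀ i, Module.finrank ℚ (k i) = 2) (φ : K →+* ℂ) {i : Fin 3}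
    (hφ : ∀ x, φ (σ i x) = starRingEnd ℂ (φ x)) :
    Nat.card (((ratSqUnits K).comap (unitsProd k)).map (unitSigns k)) = 1 := by
  rw [Subgroup.card_eq_one, eq_bot_iff]
  rintro _ ⟨v, hv, rfl⟩
  exact unitSigns_eq_one_of_unitsProd_mem hK hσ hk_deg φ hφ hv

end

/-! ### Infinite places, unit ranks and fundamental units -/

section

variable (k : Type*) [Field k] [NumberField k]

theorem exists_smul_infinitePlace_eq [IsGalois ℚ k] (v w : InfinitePlace k) :
    ∃ g : Gal(k/ℚ), g • v = w :=
  InfinitePlace.exists_smul_eq_of_comap_eq (Subsingleton.elim _ _)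

variable {k}

theorem isTotallyReal_of_isReal [IsGalois ℚ k] {φ : k →+* ℂ} (hφ : ComplexEmbedding.IsReal φ) :
    IsTotallyReal k := ⟨fun w => by
  obtain ⟨g, rfl⟩ := exists_smul_infinitePlace_eq k (InfinitePlace.mk φ) w
  rw [InfinitePlace.isReal_smul_iff]
  exact InfinitePlace.isReal_mk_iff.mpr hφ⟩

theorem isTotallyComplex_of_not_isReal [IsGalois ℚ k] {φ : k →+* ℂ}
    (hφ : ¬ ComplexEmbedding.IsReal φ) : IsTotallyComplex k := ⟨fun w => by
  obtain ⟨g, rfl⟩ := exists_smul_infinitePlace_eq k (InfinitePlace.mk φ) w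
  rw [InfinitePlace.isComplex_smul_iff]
  exact InfinitePlace.isComplex_mk_iff.mpr hφ⟩

variable (k) in
theorem rank_of_isTotallyReal [IsTotallyReal k] : Units.rank k = Module.finrank ℚ k - 1 := by
  rw [Units.rank, InfinitePlace.card_eq_nrRealPlaces_add_nrComplexPlaces, IsTotallyReal.finrank,
    IsTotallyReal.nrComplexPlaces_eq_zero, add_zero]

variable (k) in
theorem rank_of_isTotallyComplex [IsTotallyComplex k] :
    Units.rank k = Module.finrank ℚ k / 2 - 1 := by
  rw [Units.rank, InfinitePlace.card_eq_nrRealPlaces_add_nrComplexPlaces, IsTotallyComplex.finrank,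
    IsTotallyComplex.nrRealPlaces_eq_zero, zero_add, Nat.mul_div_cancel_left _ two_pos]

theorem exists_isFundamentalUnit (φ : k →+* ℝ) (hrank : Units.rank k = 1) :
    ∃ ε : (𝓞 k)ˣ, IsFundamentalUnit φ ε := by
  have habs : ∀ u : (𝓞 k)ˣ, |φ (u : k)| = 1 → u = 1 ∨ u = -1 := fun u hu => by
    have hcases : (u : k) = 1 ∨ (u : k) = -1 := by
      rcases (abs_eq zero_le_one).mp hu with h | h
      · exact .inl (φ.injective (by rw [h, map_one]))
      · exact .inr (φ.injective (by rw [h, map_neg, map_one]))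
    exact hcases.imp (fun h => Units.coe_injective k (h.trans coe_one.symm))
      (fun h => Units.coe_injective k (h.trans coe_neg_one.symm))
  let i0 : Fin (Units.rank k) := ⟨0, by omega⟩
  have hi0 : ∀ i, i = i0 := fun i => Fin.ext (by change i.1 = 0; omega)
  set η := fundSystem k i0 with hη
  have hprod : ∀ e : Fin (Units.rank k) → ℤ, ∏ i, fundSystem k i ^ e i = η ^ e i0 := fun e => by
    rw [Finset.prod_eq_single i0 (fun i _ h => absurd (hi0 i) h) (by simp)]
  have hgen : ∀ u : (𝓞 k)ˣ, ∃ n : ℤ, u = η ^ n ∨ u = -η ^ n := fun u => by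
    obtain ⟨⟨ζ, e⟩, h, -⟩ := exist_unique_eq_mul_prod k u
    rw [hprod] at h
    refine ⟨e i0, ?_⟩
    obtain ⟨m, hm, hζ⟩ := isOfFinOrder_iff_pow_eq_one.mp ζ.2
    have hζ1 : |φ ((ζ : (𝓞 k)ˣ) : k)| = 1 := by
      rw [← pow_eq_one_iff_of_nonneg (abs_nonneg _) hm.ne', ← abs_pow, ← map_pow, ← coe_pow, hζ,
        coe_one, map_one, abs_one]
    rcases habs _ hζ1 with h1 | h1
    · left; rw [h, h1, one_mul]
    · right; rw [h, h1, neg_one_mul]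
  have hη1 : |φ (η : k)| ≠ 1 := fun h1 => by
    have hη2 : η ∈ torsion k := by
      rw [torsion, CommGroup.mem_torsion, isOfFinOrder_iff_pow_eq_one]
      refine ⟨2, two_pos, ?_⟩
      rcases habs _ h1 with h | h <;> rw [h] <;> simp
    -- A torsion `η` would have both exponents `0` and `1` in the unique decomposition.
    have huniq := (exist_unique_eq_mul_prod k η).unique
      (y₁ := (⟨η, hη2⟩, 0)) (y₂ := (1, fun _ => 1)) (by simp) (by simp only [hprod]; simp)
    have := congrFun (congrArg Prod.snd huniq) i0
    simp at this
  have hη0 : φ (η : k) ≠ 0 := (map_ne_zero φ).mpr (coe_ne_zero η)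
  -- replacing a generator by its inverse or its negative
  have hinv : ∀ θ : (𝓞 k)ˣ, (∀ u : (𝓞 k)ˣ, ∃ n : ℤ, u = θ ^ n ∨ u = -θ ^ n) →
      ∀ u : (𝓞 k)ˣ, ∃ n : ℤ, u = θ⁻¹ ^ n ∨ u = -θ⁻¹ ^ n := fun θ h u => by
    obtain ⟨n, hn⟩ := h u
    exact ⟨-n, by simpa using hn⟩
  have hneg : ∀ θ : (𝓞 k)ˣ, (∀ u : (𝓞 k)ˣ, ∃ n : ℤ, u = θ ^ n ∨ u = -θ ^ n) →
      ∀ u : (𝓞 k)ˣ, ∃ n : ℤ, u = (-θ) ^ n ∨ u = -(-θ) ^ n := fun θ h u => by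
    obtain ⟨n, hn⟩ := h u
    refine ⟨n, ?_⟩
    rcases Int.even_or_odd n with he | ho
    · rwa [he.neg_zpow]
    · rw [ho.neg_zpow, neg_neg]
      exact hn.symm
  obtain ⟨θ, hθ, hθ1⟩ : ∃ θ : (𝓞 k)ˣ, (∀ u : (𝓞 k)ˣ, ∃ n : ℤ, u = θ ^ n ∨ u = -θ ^ n) ∧
      1 < |φ (θ : k)| := by
    rcases lt_or_gt_of_ne hη1 with h | h
    · refine ⟨η⁻¹, hinv η hgen, ?_⟩
      have : ((η⁻¹ : (𝓞 k)ˣ) : k) = (η : k)⁻¹ := by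
        refine eq_inv_of_mul_eq_one_left ?_
        rw [← coe_mul, inv_mul_cancel, coe_one]
      rw [this, map_inv₀, abs_inv]
      exact (one_lt_inv₀ (abs_pos.mpr hη0)).mpr h
    · exact ⟨η, hgen, h⟩
  rcases lt_abs.mp hθ1 with h | h
  · exact ⟨θ, h, hθ⟩
  · refine ⟨-θ, ?_, hneg θ hθ⟩
    rw [Units.val_neg, map_neg, map_neg]
    exact h

/-- Every unit is `±ε ^ n` and `-1` has norm 1, so the norm `-1` occurs exactly when `ε` itself has
it. -/
theorem nu_eq_zero_iff (hk : Module.finrank ℚ k = 2) [IsTotallyReal k] :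
    nu k = 0 ↔ ∃ u, unitNorm k u = -1 := by
  have hrank : Units.rank k = 1 := by rw [rank_of_isTotallyReal, hk]
  let φ : k →+* ℂ := Classical.arbitrary _
  let φ' := (IsTotallyReal.complexEmbedding_isReal φ).embedding
  obtain ⟨ε, hε⟩ := exists_isFundamentalUnit φ' hrank
  rw [nu]
  constructor
  · intro h
    refine ⟨ε, (Int.units_eq_one_or _).resolve_left fun h1 => ?_⟩
    rw [if_pos ⟨φ', ε, hε, (unitNorm_eq_one_iff ε).mp h1⟩] at h
    exact one_ne_zero h
  · rintro ⟨u, hu⟩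
    refine if_neg ?_
    rintro ⟨φ, θ, ⟨-, hθ⟩, h1⟩
    rw [← unitNorm_eq_one_iff] at h1
    have hm1 : unitNorm k (-1) = 1 := by
      refine unitNorm_eq_one_of_pos ?_
      rw [coe_neg_one, ← map_one (algebraMap ℚ k), ← map_neg, Algebra.norm_algebraMap, hk]
      norm_num
    obtain ⟨n, rfl | rfl⟩ := hθ u
    · rw [map_zpow, h1, one_zpow] at hu
      exact absurd hu (by decide)
    · rw [← neg_one_mul, map_mul, hm1, map_zpow, h1, one_zpow] at hu
      exact absurd hu (by decide)

end

/-! ### Complex conjugation on `K` and additivity of the rank -/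

section

variable {K : Type*} [Field K] [NumberField K] {k : Fin 3 → IntermediateField ℚ K}
  {σ : Fin 3 → Gal(K/ℚ)}

/-- If `K` is not totally real, complex conjugation induces one of the `σ i`. -/
theorem exists_conj_of_not_isTotallyReal [IsGalois ℚ K] (hσ : IsConjSystem k σ)
    (hreal : ¬ IsTotallyReal K) :
    ∃ (φ : K →+* ℂ) (i : Fin 3), ∀ x, φ (σ i x) = starRingEnd ℂ (φ x) := by
  let φ : K →+* ℂ := Classical.arbitrary _
  have hφ : ¬ ComplexEmbedding.IsReal φ := fun h => hreal (isTotallyReal_of_isReal h)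
  obtain ⟨g, hg⟩ := ComplexEmbedding.exists_comp_symm_eq_of_comp_eq (k := ℚ) φ
    (ComplexEmbedding.conjugate φ) (Subsingleton.elim _ _)
  have hg' : ∀ x, φ (g.symm x) = starRingEnd ℂ (φ x) := fun x => RingHom.congr_fun hg x
  obtain ⟨i, hi⟩ := hσ.eq_of_ne_one g.symm fun h => hφ (by
    rw [ComplexEmbedding.isReal_iff]
    ext x
    rw [ComplexEmbedding.conjugate_coe_eq, ← hg', h, AlgEquiv.one_apply])
  exact ⟨φ, i, fun x => by rw [← hi, hg']⟩

/-- The ranks are 3 = 1 + 1 + 1 for real `K`; otherwise 1 = 1 + 0 + 0, the only real quadratic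
subfield being the one fixed by complex conjugation. -/
theorem rank_eq_sum_rank [IsGalois ℚ K] (hK : IsKleinFour Gal(K/ℚ)) (hσ : IsConjSystem k σ)
    (hk_deg : ∀ i, Module.finrank ℚ (k i) = 2) : Units.rank K = ∑ i, Units.rank (k i) := by
  have hKdeg : Module.finrank ℚ K = 4 := by rw [← IsGalois.card_aut_eq_finrank, hK.card_four]
  by_cases hreal : IsTotallyReal K
  · have : ∀ i, IsTotallyReal (k i) := fun i => IsTotallyReal.of_algebra (k i) K
    simp [rank_of_isTotallyReal, hKdeg, hk_deg]
  · obtain ⟨φ, i, hφ⟩ := exists_conj_of_not_isTotallyReal hσ hreal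
    have hgal : ∀ l, IsGalois ℚ (k l) := fun l => (exists_conj_of_finrank_eq_two (hk_deg l)).1
    have hφ' : ¬ ComplexEmbedding.IsReal φ := fun h => hreal (isTotallyReal_of_isReal h)
    have : IsTotallyComplex K := isTotallyComplex_of_not_isReal hφ'
    rw [Finset.sum_eq_single i, rank_of_isTotallyComplex, hKdeg]
    · have : IsTotallyReal (k i) := by
        refine isTotallyReal_of_isReal (φ := φ.comp (algebraMap (k i) K)) ?_
        rw [ComplexEmbedding.isReal_iff]
        ext x
        rw [ComplexEmbedding.conjugate_coe_eq, RingHom.comp_apply, ← hφ]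
        exact congrArg φ ((hσ.apply_eq_iff i _).mpr x.2)
      rw [rank_of_isTotallyReal, hk_deg]
    · intro l _ hl
      have : IsTotallyComplex (k l) := by
        refine isTotallyComplex_of_not_isReal (φ := φ.comp (algebraMap (k l) K)) fun h => ?_
        refine hσ.fields_injective.ne hl (IntermediateField.eq_of_le_of_finrank_eq
          (fun x hx => ?_) (by rw [hk_deg, hk_deg]))
        rw [← hσ.apply_eq_iff]
        apply φ.injective
        rw [hφ]
        exact RingHom.congr_fun (ComplexEmbedding.isReal_iff.mp h) (⟨x, hx⟩ : k l)
      rw [rank_of_isTotallyComplex, hk_deg, Nat.div_self two_pos, Nat.sub_self]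
    · simp

end

/-! ### Primes above `p` and the ideals `Π_q` -/

section

variable (k : Type*) [Field k] [NumberField k]

/-- The common ramification index of the primes above `p` in the Galois number field `k`. -/
def ramIdx (p : Nat.Primes) : ℕ :=
  (Ideal.span {((p : ℕ) : ℤ)}).ramificationIdxIn (𝓞 k)

/-- The product of the prime ideals above `p`. -/
def radIdeal (p : Nat.Primes) : Ideal (𝓞 k) :=
  ∏ᶠ P ∈ (Ideal.span {((p : ℕ) : ℤ)}).primesOver (𝓞 k), P

instance isPrime_span_prime (p : Nat.Primes) : (Ideal.span {((p : ℕ) : ℤ)}).IsPrime :=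
  (Ideal.span_singleton_prime (by exact_mod_cast p.2.ne_zero)).mpr
    (Nat.prime_iff_prime_int.mp p.2)

theorem span_prime_ne_bot (p : Nat.Primes) : Ideal.span {((p : ℕ) : ℤ)} ≠ ⊥ := by
  rw [Ne, Ideal.span_singleton_eq_bot]
  exact_mod_cast p.2.ne_zero

instance isMaximal_span_prime (p : Nat.Primes) : (Ideal.span {((p : ℕ) : ℤ)}).IsMaximal :=
  (isPrime_span_prime p).isMaximal (span_prime_ne_bot p)

theorem mem_primesOver_iff {k : Type*} [Field k] {p : Nat.Primes} {P : Ideal (𝓞 k)} :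
    P ∈ (Ideal.span {((p : ℕ) : ℤ)}).primesOver (𝓞 k) ↔ P.IsPrime ∧ ((p : ℕ) : 𝓞 k) ∈ P := by
  constructor
  · rintro ⟨h1, h2⟩
    refine ⟨h1, ?_⟩
    have := (Ideal.liesOver_span_iff h1.ne_top (Nat.prime_iff_prime_int.mp p.2)).mp h2
    simpa using this
  · rintro ⟨h1, h2⟩
    exact ⟨h1, (Ideal.liesOver_span_iff h1.ne_top (Nat.prime_iff_prime_int.mp p.2)).mpr
      (by simpa using h2)⟩

theorem finite_primesOver (p : Nat.Primes) :
    ((Ideal.span {((p : ℕ) : ℤ)}).primesOver (𝓞 k)).Finite :=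
  IsDedekindDomain.primesOver_finite _ _

variable {k} in
theorem ne_bot_of_mem_primesOver {p : Nat.Primes} {P : Ideal (𝓞 k)}
    (hP : P ∈ (Ideal.span {((p : ℕ) : ℤ)}).primesOver (𝓞 k)) : P ≠ ⊥ := by
  rintro rfl
  have := (mem_primesOver_iff.mp hP).2
  rw [Ideal.mem_bot] at this
  exact p.2.ne_zero (by exact_mod_cast this)

theorem radIdeal_mem_nonZeroDivisors (p : Nat.Primes) :
    radIdeal k p ∈ nonZeroDivisors (Ideal (𝓞 k)) :=
  finprod_mem_induction (· ∈ nonZeroDivisors (Ideal (𝓞 k))) (one_mem _)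
    (fun _ _ hx hy => mul_mem hx hy)
    (fun _ hP => mem_nonZeroDivisors_iff_ne_zero.mpr (ne_bot_of_mem_primesOver hP))

variable {k} in
theorem ramificationIdx_eq_ramIdx [IsGalois ℚ k] {p : Nat.Primes} {P : Ideal (𝓞 k)}
    (hP : P ∈ (Ideal.span {((p : ℕ) : ℤ)}).primesOver (𝓞 k)) :
    P.ramificationIdx ℤ = ramIdx k p := by
  have := hP.1
  have := hP.2
  exact (Ideal.ramificationIdxIn_eq_ramificationIdx _ P Gal(k/ℚ)).symm

theorem span_eq_radIdeal_pow [IsGalois ℚ k] (p : Nat.Primes) :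
    Ideal.span {((p : ℕ) : 𝓞 k)} = radIdeal k p ^ ramIdx k p := by
  have h := Ideal.map_algebraMap_eq_finsetProd_pow (R := 𝓞 k) (span_prime_ne_bot p)
  rw [Ideal.map_span, Set.image_singleton, map_natCast] at h
  rw [h, radIdeal, finprod_mem_eq_toFinset_prod, ← Finset.prod_pow]
  refine Finset.prod_congr rfl fun P hP => ?_
  rw [ramificationIdx_eq_ramIdx (Set.mem_toFinset.mp hP)]

-- In a Galois field all primes above `p` have norm `p ^ f` with the same `f`, and the norm of a
-- prime determines `p`.
variable {k} in
theorem polyaIdeal_absNorm_eq_radIdeal [IsGalois ℚ k] {p : Nat.Primes} {P : Ideal (𝓞 k)}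
    (hP : P ∈ (Ideal.span {((p : ℕ) : ℤ)}).primesOver (𝓞 k)) :
    polyaIdeal k (Ideal.absNorm P) = radIdeal k p := by
  rw [polyaIdeal, radIdeal]
  have hnorm : ∀ Q ∈ (Ideal.span {((p : ℕ) : ℤ)}).primesOver (𝓞 k),
      Ideal.absNorm Q = (p : ℕ) ^ (Ideal.span {((p : ℕ) : ℤ)}).inertiaDegIn (𝓞 k) := fun Q hQ => by
    have := hQ.1
    have := hQ.2
    rw [Ideal.inertiaDegIn_eq_inertiaDeg _ Q Gal(k/ℚ),
      ← Ideal.natAbs_pow_inertiaDeg ((p : ℕ) : ℤ) Q]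
    simp
  have hset : {Q : Ideal (𝓞 k) | Q.IsPrime ∧ Q ≠ ⊥ ∧ Ideal.absNorm Q = Ideal.absNorm P} =
      (Ideal.span {((p : ℕ) : ℤ)}).primesOver (𝓞 k) := by
    ext Q
    constructor
    · rintro ⟨h1, -, h2⟩
      refine mem_primesOver_iff.mpr ⟨h1, ?_⟩
      have h3 := Ideal.absNorm_mem Q
      rw [h2, hnorm P hP, Nat.cast_pow] at h3
      exact h1.mem_of_pow_mem _ h3
    · intro hQ
      exact ⟨hQ.1, ne_bot_of_mem_primesOver hQ, by rw [hnorm Q hQ, hnorm P hP]⟩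
  rw [hset]

theorem exists_polyaIdeal_eq_radIdeal [IsGalois ℚ k] (p : Nat.Primes) :
    ∃ q, polyaIdeal k q = radIdeal k p := by
  obtain ⟨P⟩ : Nonempty ((Ideal.span {((p : ℕ) : ℤ)}).primesOver (𝓞 k)) := inferInstance
  exact ⟨_, polyaIdeal_absNorm_eq_radIdeal P.2⟩

theorem polyaIdeal_eq_one_or_radIdeal [IsGalois ℚ k] (q : ℕ) :
    polyaIdeal k q = 1 ∨ ∃ p, polyaIdeal k q = radIdeal k p := by
  by_cases h : ∃ P : Ideal (𝓞 k), P.IsPrime ∧ P ≠ ⊥ ∧ Ideal.absNorm P = q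
  · obtain ⟨P, h1, h2, rfl⟩ := h
    right
    have hne1 : Ideal.absNorm P ≠ 1 := fun h => h1.ne_top (Ideal.absNorm_eq_one_iff.mp h)
    have hprod : ∀ n : ℕ, n ≠ 0 → (n : 𝓞 k) ∈ P → ∃ p : Nat.Primes, ((p : ℕ) : 𝓞 k) ∈ P := by
      intro n
      induction n using Nat.recOnMul with
      | zero => exact fun h => absurd rfl h
      | one => exact fun _ h => absurd ((Ideal.eq_top_iff_one P).mpr (by simpa using h)) h1.ne_top
      | prime p hp => exact fun _ h => ⟨⟨p, hp⟩, h⟩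
      | mul a b ha hb =>
        intro h0 h
        rw [Nat.cast_mul] at h
        rcases h1.mem_or_mem h with h | h
        exacts [ha (left_ne_zero_of_mul h0) h, hb (right_ne_zero_of_mul h0) h]
    obtain ⟨p, hp⟩ := hprod _ (mt Ideal.absNorm_eq_zero_iff.mp h2) (Ideal.absNorm_mem P)
    exact ⟨p, polyaIdeal_absNorm_eq_radIdeal (mem_primesOver_iff.mpr ⟨h1, hp⟩)⟩
  · left
    rw [polyaIdeal]
    exact finprod_mem_of_eqOn_one fun P hP => absurd ⟨P, hP⟩ h

/-- The primes that ramify with even index in the Galois number field `k`. -/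
def evenPrimes : Set Nat.Primes := {p | Even (ramIdx k p)}

theorem ramIdx_eq_one_of_not_dvd_discr [IsGalois ℚ k] {p : Nat.Primes}
    (hp : ¬ ((p : ℕ) : ℤ) ∣ discr k) : ramIdx k p = 1 := by
  obtain ⟨P⟩ : Nonempty ((Ideal.span {((p : ℕ) : ℤ)}).primesOver (𝓞 k)) := inferInstance
  have hP := P.2
  have hprime := hP.1
  have := (not_dvd_discr_iff_forall_liesOver k (𝓞 k) (Nat.prime_iff_prime_int.mp p.2)).mp hp P.1
    (hprime.isMaximal (ne_bot_of_mem_primesOver hP)) hP.2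
  rw [← ramificationIdx_eq_ramIdx hP, Ideal.ramificationIdx_eq_one_of_isUnramifiedAt]

theorem finite_ramIdx_ne_one [IsGalois ℚ k] : {p : Nat.Primes | ramIdx k p ≠ 1}.Finite := by
  refine Set.Finite.of_finite_image (f := fun p : Nat.Primes => (p : ℕ)) ?_
    (fun p _ q _ h => Subtype.ext h)
  refine (Set.finite_Iic (discr k).natAbs).subset ?_
  rintro _ ⟨p, hp, rfl⟩
  refine Nat.le_of_dvd (Int.natAbs_pos.mpr (discr_ne_zero k)) (Int.natCast_dvd.mp ?_)
  by_contra h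
  exact hp (ramIdx_eq_one_of_not_dvd_discr k h)

theorem finite_evenPrimes [IsGalois ℚ k] : (evenPrimes k).Finite :=
  (finite_ramIdx_ne_one k).subset fun p hp h => by
    have hp : Even (ramIdx k p) := hp
    rw [h] at hp
    exact absurd hp (by decide)

end

/-! ### Ideals with rational square, modulo rational ideals -/

section

variable (k : Type*) [Field k] [NumberField k]

/-- The fractional ideal generated by a nonzero rational number. -/
def ratIdeal : ℚˣ →* (FractionalIdeal (𝓞 k)⁰ k)ˣ :=
  (toPrincipalIdeal (𝓞 k) k).comp (Units.map (algebraMap ℚ k).toMonoidHom)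

theorem range_ratIdeal : (ratIdeal k).range = ratIdeals k := MonoidHom.range_comp _ _

theorem mem_ratIdeals {c : (FractionalIdeal (𝓞 k)⁰ k)ˣ} :
    c ∈ ratIdeals k ↔ ∃ r, ratIdeal k r = c := by
  rw [← range_ratIdeal, MonoidHom.mem_range]

theorem mem_sqrtRatIdeals {c : (FractionalIdeal (𝓞 k)⁰ k)ˣ} :
    c ∈ sqrtRatIdeals k ↔ ∃ r, ratIdeal k r = c ^ 2 := by
  rw [sqrtRatIdeals, Subgroup.mem_comap, mem_ratIdeals, powMonoidHom_apply]

theorem coe_ratIdeal (r : ℚˣ) :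
    (ratIdeal k r : FractionalIdeal (𝓞 k)⁰ k) =
      FractionalIdeal.spanSingleton (𝓞 k)⁰ ((r : ℚ) : k) := by
  rw [ratIdeal, MonoidHom.comp_apply, coe_toPrincipalIdeal]
  rfl

theorem ratIdeal_eq_one_iff {r : ℚˣ} : ratIdeal k r = 1 ↔ r = 1 ∨ r = -1 := by
  constructor
  · intro h
    obtain ⟨u, hu⟩ := (toPrincipalIdeal_eq_one_iff k).mp h
    have h1 := sq_eq_one_of_mem_ratUnits k (u := u) (hu ▸ ⟨r, rfl⟩)
    have h2 : Units.map (algebraMap ℚ k).toMonoidHom (r ^ 2) = 1 := by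
      rw [map_pow, ← hu, ← map_pow, h1, map_one]
    have h3 : (r : ℚ) ^ 2 = 1 := (algebraMap ℚ k).injective (by
      simpa using congrArg Units.val h2)
    exact (sq_eq_sq_iff_eq_or_eq_neg.mp (h3.trans (one_pow 2).symm)).imp Units.ext Units.ext
  · rintro (rfl | rfl)
    · exact map_one _
    · refine (toPrincipalIdeal_eq_one_iff k).mpr ⟨-1, ?_⟩
      ext
      simp

-- Fractional ideals are determined by their exponents at the primes, and doubling is injective on
-- `ℤ`.
variable {k} in
theorem sq_injective_fractionalIdeal {c d : (FractionalIdeal (𝓞 k)⁰ k)ˣ} (h : c ^ 2 = d ^ 2) :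
    c = d := by
  have hc : ∀ v, FractionalIdeal.count k v (c : FractionalIdeal (𝓞 k)⁰ k) =
      FractionalIdeal.count k v (d : FractionalIdeal (𝓞 k)⁰ k) := fun v => by
    have h1 := congrArg (fun c : (FractionalIdeal (𝓞 k)⁰ k)ˣ =>
      FractionalIdeal.count k v (c : FractionalIdeal (𝓞 k)⁰ k)) h
    simp only [Units.val_pow_eq_pow_val, FractionalIdeal.count_pow] at h1
    exact mul_left_cancel₀ (by norm_num) h1
  apply Units.ext
  rw [← FractionalIdeal.finprod_heightOneSpectrum_factorization' k c.ne_zero,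
    ← FractionalIdeal.finprod_heightOneSpectrum_factorization' k d.ne_zero]
  simp only [hc]

/-- The product of the primes above `p`, as an invertible fractional ideal. -/
def radUnit (p : Nat.Primes) : (FractionalIdeal (𝓞 k)⁰ k)ˣ :=
  FractionalIdeal.mk0 k ⟨radIdeal k p, radIdeal_mem_nonZeroDivisors k p⟩

/-- A prime number, as a unit of `ℚ`. -/
def primeUnit (p : Nat.Primes) : ℚˣ := Units.mk0 ((p : ℕ) : ℚ) (by exact_mod_cast p.2.ne_zero)

/-- The square root of the ideal generated by a prime with even ramification index. -/
def sqrtPrime (p : Nat.Primes) : (FractionalIdeal (𝓞 k)⁰ k)ˣ := radUnit k p ^ (ramIdx k p / 2)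

theorem radUnit_pow_ramIdx [IsGalois ℚ k] (p : Nat.Primes) :
    radUnit k p ^ ramIdx k p = ratIdeal k (primeUnit p) := by
  ext1
  rw [Units.val_pow_eq_pow_val, coe_ratIdeal, radUnit, FractionalIdeal.coe_mk0,
    ← FractionalIdeal.coeIdeal_pow, ← span_eq_radIdeal_pow, FractionalIdeal.coeIdeal_span_singleton]
  simp [primeUnit]

theorem sqrtPrime_sq [IsGalois ℚ k] {p : Nat.Primes} (hp : p ∈ evenPrimes k) :
    sqrtPrime k p ^ 2 = ratIdeal k (primeUnit p) := by
  rw [sqrtPrime, ← pow_mul, Nat.div_mul_cancel (even_iff_two_dvd.mp hp), radUnit_pow_ramIdx]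

open Classical in
theorem count_radUnit (p : Nat.Primes) (v : IsDedekindDomain.HeightOneSpectrum (𝓞 k)) :
    FractionalIdeal.count k v (radUnit k p : FractionalIdeal (𝓞 k)⁰ k) =
      if v.asIdeal ∈ (Ideal.span {((p : ℕ) : ℤ)}).primesOver (𝓞 k) then 1 else 0 := by
  have hcoe : (radUnit k p : FractionalIdeal (𝓞 k)⁰ k) = (radIdeal k p : Ideal (𝓞 k)) :=
    FractionalIdeal.coe_mk0 k _
  have hprod : ∀ t : Finset (Ideal (𝓞 k)), ((∏ P ∈ t, P : Ideal (𝓞 k)) :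
      FractionalIdeal (𝓞 k)⁰ k) = ∏ P ∈ t, (P : FractionalIdeal (𝓞 k)⁰ k) := fun t =>
    map_prod (FractionalIdeal.coeIdealHom (𝓞 k)⁰ k) _ _
  rw [hcoe, radIdeal, finprod_mem_eq_finite_toFinset_prod _ (finite_primesOver k p), hprod,
    FractionalIdeal.count_prod _ _ _ _ fun P hP => by
      rw [FractionalIdeal.coeIdeal_ne_zero]
      exact ne_bot_of_mem_primesOver ((finite_primesOver k p).mem_toFinset.mp hP)]
  have h1 : ∀ P ∈ (finite_primesOver k p).toFinset,
      FractionalIdeal.count k v (P : FractionalIdeal (𝓞 k)⁰ k) = if P = v.asIdeal then 1 else 0 :=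
    fun P hP => by
      have hP := (finite_primesOver k p).mem_toFinset.mp hP
      have := FractionalIdeal.count_maximal k v ⟨P, hP.1, ne_bot_of_mem_primesOver hP⟩
      rw [this]
      simp [IsDedekindDomain.HeightOneSpectrum.ext_iff]
  rw [Finset.sum_congr rfl h1, Finset.sum_ite_eq']
  simp

theorem count_ratIdeal [IsGalois ℚ k] {p : Nat.Primes}
    (v : IsDedekindDomain.HeightOneSpectrum (𝓞 k))
    (hv : v.asIdeal ∈ (Ideal.span {((p : ℕ) : ℤ)}).primesOver (𝓞 k)) (r : ℚˣ) :
    FractionalIdeal.count k v (ratIdeal k r : FractionalIdeal (𝓞 k)⁰ k) =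
      ramIdx k p * padicValRat p r := by
  have : Fact (p : ℕ).Prime := ⟨p.2⟩
  have hnat : ∀ (n : ℕ) (hn : (n : ℚ) ≠ 0), FractionalIdeal.count k v
      (ratIdeal k (Units.mk0 (n : ℚ) hn) : FractionalIdeal (𝓞 k)⁰ k) =
      ramIdx k p * padicValRat p n := by
    intro n
    induction n using Nat.recOnMul with
    | zero => exact fun h => absurd Nat.cast_zero h
    | one =>
      intro h
      have : Units.mk0 ((1 : ℕ) : ℚ) h = 1 := by ext; simp
      rw [this, map_one, Units.val_one, FractionalIdeal.count_one]
      simp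
    | prime l hl =>
      obtain ⟨l, rfl⟩ : ∃ l' : Nat.Primes, (l' : ℕ) = l := ⟨⟨l, hl⟩, rfl⟩
      intro h
      have h1 : _ = ratIdeal k (Units.mk0 ((l : ℕ) : ℚ) h) := radUnit_pow_ramIdx k l
      rw [← h1, Units.val_pow_eq_pow_val, FractionalIdeal.count_pow, count_radUnit]
      by_cases hlp : l = p
      · rw [hlp, if_pos hv, padicValRat.self p.2.one_lt]
      · rw [if_neg, padicValRat.of_nat, padicValNat_primes (hq := ⟨l.2⟩)
          (fun h => hlp (Subtype.ext h.symm))]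
        · simp
        · intro h2
          have h3 := h2.2.over.trans hv.2.over.symm
          rw [Ideal.span_singleton_eq_span_singleton, Int.associated_iff_natAbs] at h3
          exact hlp (Subtype.ext (by simpa using h3))
    | mul a b ha hb =>
      intro h
      rw [Nat.cast_mul] at h
      have ha0 := left_ne_zero_of_mul h
      have hb0 := right_ne_zero_of_mul h
      have h1 : Units.mk0 ((a * b : ℕ) : ℚ) (by rwa [Nat.cast_mul]) =
        Units.mk0 (a : ℚ) ha0 * Units.mk0 (b : ℚ) hb0 := by ext; simp
      rw [h1, map_mul, Units.val_mul, FractionalIdeal.count_mul _ _ (Units.ne_zero _)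
        (Units.ne_zero _), ha, hb, Nat.cast_mul, padicValRat.mul ha0 hb0, mul_add]
  have hnum : ((r : ℚ).num.natAbs : ℚ) ≠ 0 := by
    exact_mod_cast Int.natAbs_ne_zero.mpr (Rat.num_ne_zero.mpr r.ne_zero)
  have hden : ((r : ℚ).den : ℚ) ≠ 0 := by exact_mod_cast (r : ℚ).den_ne_zero
  obtain ⟨s, hs, hr⟩ : ∃ s : ℚˣ, (s = 1 ∨ s = -1) ∧
      r * Units.mk0 _ hden = s * Units.mk0 _ hnum := by
    have h1 : (r : ℚ) * (r : ℚ).den = (r : ℚ).num := Rat.mul_den_eq_num _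
    rcases Int.natAbs_eq (r : ℚ).num with h | h
    · refine ⟨1, .inl rfl, ?_⟩
      ext
      rw [one_mul, Units.val_mul, Units.val_mk0, Units.val_mk0, h1]
      exact (congrArg _ h).trans (Int.cast_natCast _)
    · refine ⟨-1, .inr rfl, ?_⟩
      ext
      rw [neg_one_mul, Units.val_mul, Units.val_neg, Units.val_mk0, Units.val_mk0, h1]
      exact (congrArg _ h).trans (by rw [Int.cast_neg, Int.cast_natCast])
  have h1 := congrArg (ratIdeal k) hr
  rw [map_mul, map_mul, (ratIdeal_eq_one_iff k).mpr hs, one_mul] at h1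
  have h2 := congrArg (fun c : (FractionalIdeal (𝓞 k)⁰ k)ˣ =>
      FractionalIdeal.count k v (c : FractionalIdeal (𝓞 k)⁰ k)) h1
  simp only [Units.val_mul, hnat] at h2
  rw [FractionalIdeal.count_mul _ _ (Units.ne_zero _) (Units.ne_zero _), hnat] at h2
  have h3 : padicValRat p r + padicValRat p (r : ℚ).den = padicValRat p (r : ℚ).num.natAbs := by
    rw [← padicValRat.mul r.ne_zero hden]
    have h4 := congrArg Units.val hr
    rw [Units.val_mul, Units.val_mul, Units.val_mk0, Units.val_mk0] at h4
    rw [h4]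
    rcases hs with rfl | rfl <;> simp
  linear_combination h2 - (ramIdx k p : ℤ) * h3

-- At a prime above `p` the exponent of `(r) = c²` is even and equals `ramIdx k p` times the
-- valuation of `r`.
variable {k} in
theorem mem_evenPrimes_of_odd [IsGalois ℚ k] {p : Nat.Primes} {c : (FractionalIdeal (𝓞 k)⁰ k)ˣ}
    {r : ℚˣ} (h : ratIdeal k r = c ^ 2) (hr : Odd (padicValRat p r)) : p ∈ evenPrimes k := by
  obtain ⟨P⟩ : Nonempty ((Ideal.span {((p : ℕ) : ℤ)}).primesOver (𝓞 k)) := inferInstance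
  have h1 := count_ratIdeal k ⟨P.1, P.2.1, ne_bot_of_mem_primesOver P.2⟩ P.2 r
  rw [h, Units.val_pow_eq_pow_val, FractionalIdeal.count_pow] at h1
  have h2 : Even ((ramIdx k p : ℤ) * padicValRat p r) := by
    rw [← h1]
    exact ⟨_, two_mul _⟩
  rcases Int.even_mul.mp h2 with h3 | h3
  · exact (Int.even_coe_nat _).mp h3
  · exact absurd h3 (Int.not_even_iff_odd.mpr hr)

open Classical in
theorem padicValRat_prod_primeUnit (T : Finset Nat.Primes) (p : Nat.Primes) :
    padicValRat p ((∏ l ∈ T, primeUnit l : ℚˣ) : ℚ) = if p ∈ T then 1 else 0 := by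
  have : Fact (p : ℕ).Prime := ⟨p.2⟩
  induction T using Finset.induction_on with
  | empty => simp
  | insert l T hl ih =>
    rw [Finset.prod_insert hl, Units.val_mul, padicValRat.mul (Units.ne_zero _) (Units.ne_zero _)]
    have h1 : padicValRat p (primeUnit l : ℚ) = if p = l then 1 else 0 := by
      change padicValRat p ((l : ℕ) : ℚ) = _
      split_ifs with h
      · rw [h, padicValRat.self l.2.one_lt]
      · have : Fact (l : ℕ).Prime := ⟨l.2⟩
        rw [padicValRat.of_nat, padicValNat_primes (fun h' => h (Subtype.ext h')), Nat.cast_zero]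
    rw [h1, ih]
    by_cases h : p = l
    · subst h
      simp [hl]
    · simp [h]

/-- Every nonzero rational number is, up to sign, a square times a product of distinct primes. -/
theorem exists_eq_sq_mul_prod_primeUnit (r : ℚˣ) : ∃ (s : ℚˣ) (T : Finset Nat.Primes),
    r = s ^ 2 * ∏ p ∈ T, primeUnit p ∨ r = -(s ^ 2 * ∏ p ∈ T, primeUnit p) := by
  have hden : ((r : ℚ).den : ℚ) ≠ 0 := by exact_mod_cast (r : ℚ).den_ne_zero
  have hnum : (r : ℚ).num ≠ 0 := Rat.num_ne_zero.mpr r.ne_zero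
  -- `|num| · den` is `|r| · den²`, so writing it as `b² a` with `a` squarefree gives `s = b / den`,
  -- and `T` consists of the primes dividing `a`.
  obtain ⟨a, b, hab, ha⟩ := Nat.sq_mul_squarefree ((r : ℚ).num.natAbs * (r : ℚ).den)
  have hb : (b : ℚ) ≠ 0 := by
    rintro h
    rw [Nat.cast_eq_zero] at h
    subst h
    simp [hnum] at hab
  let e : {p // p ∈ a.primeFactors} ↪ Nat.Primes :=
    ⟨fun p => ⟨p.1, Nat.prime_of_mem_primeFactors p.2⟩,
      fun p q h => Subtype.ext (congrArg (fun x : Nat.Primes => (x : ℕ)) h)⟩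
  refine ⟨Units.mk0 _ hb / Units.mk0 _ hden, a.primeFactors.attach.map e, ?_⟩
  have hT : ((∏ p ∈ a.primeFactors.attach.map e, primeUnit p : ℚˣ) : ℚ) = a := by
    rw [Finset.prod_map, Units.coe_prod]
    have := Nat.prod_primeFactors_of_squarefree ha
    conv_rhs => rw [← this]
    rw [Nat.cast_prod, ← Finset.prod_attach a.primeFactors (fun p => (p : ℚ))]
    rfl
  have h1 : (r : ℚ) * (r : ℚ).den = (r : ℚ).num := Rat.mul_den_eq_num _
  have h2 : ((r : ℚ).num.natAbs : ℚ) * (r : ℚ).den = b ^ 2 * a := by exact_mod_cast hab.symm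
  rcases Int.natAbs_eq (r : ℚ).num with h | h
  · left
    ext
    rw [Units.val_mul, hT]
    have h3 : ((r : ℚ).num : ℚ) = (r : ℚ).num.natAbs :=
      (congrArg _ h).trans (Int.cast_natCast _)
    simp only [Units.val_pow_eq_pow_val, Units.val_div_eq_div_val, Units.val_mk0]
    field_simp
    linear_combination h2 + (r : ℚ).den * h1 + (r : ℚ).den * h3
  · right
    ext
    rw [Units.val_neg, Units.val_mul, hT]
    have h3 : ((r : ℚ).num : ℚ) = -((r : ℚ).num.natAbs : ℚ) :=
      (congrArg _ h).trans (by rw [Int.cast_neg, Int.cast_natCast])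
    simp only [Units.val_pow_eq_pow_val, Units.val_div_eq_div_val, Units.val_mk0]
    field_simp
    linear_combination -h2 + (r : ℚ).den * h1 + (r : ℚ).den * h3

variable {k} in
theorem prod_sqrtPrime_sq [IsGalois ℚ k] {T : Finset Nat.Primes} (hT : ↑T ⊆ evenPrimes k) :
    (∏ p ∈ T, sqrtPrime k p) ^ 2 = ratIdeal k (∏ p ∈ T, primeUnit p) := by
  rw [← Finset.prod_pow, map_prod]
  exact Finset.prod_congr rfl fun p hp => sqrtPrime_sq k (hT hp)

variable {k} in
theorem prod_sqrtPrime_mem [IsGalois ℚ k] {T : Finset Nat.Primes} (hT : ↑T ⊆ evenPrimes k) :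
    ∏ p ∈ T, sqrtPrime k p ∈ sqrtRatIdeals k :=
  (mem_sqrtRatIdeals k).mpr ⟨_, (prod_sqrtPrime_sq hT).symm⟩

-- Write `c² = (r)` and `r = ± s² ∏ p`. Each `p` in the product has odd valuation in `r`, so its
-- ramification index is even and `(p)` has a square root; square roots of ideals are unique.
variable {k} in
theorem exists_eq_ratIdeal_mul_prod_sqrtPrime [IsGalois ℚ k] {c : (FractionalIdeal (𝓞 k)⁰ k)ˣ}
    (hc : c ∈ sqrtRatIdeals k) : ∃ (s : ℚˣ) (T : Finset Nat.Primes), ↑T ⊆ evenPrimes k ∧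
      c = ratIdeal k s * ∏ p ∈ T, sqrtPrime k p := by
  classical
  obtain ⟨r, hr⟩ := (mem_sqrtRatIdeals k).mp hc
  obtain ⟨s, T, h⟩ := exists_eq_sq_mul_prod_primeUnit r
  have hT : ↑T ⊆ evenPrimes k := fun p hp => by
    have : Fact (p : ℕ).Prime := ⟨p.2⟩
    refine mem_evenPrimes_of_odd hr ?_
    have h1 : padicValRat p (r : ℚ) = padicValRat p (s ^ 2 * ∏ p ∈ T, primeUnit p : ℚˣ) := by
      rcases h with h | h <;> rw [h]
      rw [Units.val_neg, padicValRat.neg]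
    rw [h1, Units.val_mul, padicValRat.mul (Units.ne_zero _) (Units.ne_zero _),
      padicValRat_prod_primeUnit, if_pos (Finset.mem_coe.mp hp), Units.val_pow_eq_pow_val,
      padicValRat.pow]
    exact ⟨padicValRat p s, by push_cast; ring⟩
  refine ⟨s, T, hT, sq_injective_fractionalIdeal ?_⟩
  have hneg : ratIdeal k (-1) = 1 := (ratIdeal_eq_one_iff k).mpr (.inr rfl)
  have h2 : ratIdeal k r = ratIdeal k (s ^ 2 * ∏ p ∈ T, primeUnit p) := by
    rcases h with h | h <;> rw [h]
    rw [← neg_one_mul, map_mul, hneg, one_mul]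
  rw [← hr, h2, mul_pow, prod_sqrtPrime_sq hT, map_mul, map_pow]

-- After squaring, the two products of primes differ by `± s²`, and the parity of the valuations
-- recovers the sets.
variable {k} in
theorem eq_of_prod_sqrtPrime_eq [IsGalois ℚ k] {T T' : Finset Nat.Primes}
    (hT : ↑T ⊆ evenPrimes k) (hT' : ↑T' ⊆ evenPrimes k) {s : ℚˣ}
    (h : ∏ p ∈ T, sqrtPrime k p = (∏ p ∈ T', sqrtPrime k p) * ratIdeal k s) : T = T' := by
  classical
  have h1 := congrArg (· ^ 2) h
  simp only [mul_pow] at h1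
  rw [prod_sqrtPrime_sq hT, prod_sqrtPrime_sq hT', ← map_pow, ← map_mul, ← div_eq_one, ← map_div,
    ratIdeal_eq_one_iff] at h1
  ext p
  have : Fact (p : ℕ).Prime := ⟨p.2⟩
  have h2 : padicValRat p (∏ p ∈ T, primeUnit p : ℚˣ) =
      padicValRat p ((∏ p ∈ T', primeUnit p) * s ^ 2 : ℚˣ) := by
    rcases h1 with h1 | h1
    · rw [div_eq_one.mp h1]
    · rw [div_eq_iff_eq_mul.mp h1, neg_one_mul, Units.val_neg, padicValRat.neg]
  rw [Units.val_mul, padicValRat.mul (Units.ne_zero _) (Units.ne_zero _),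
    padicValRat_prod_primeUnit, padicValRat_prod_primeUnit, Units.val_pow_eq_pow_val,
      padicValRat.pow] at h2
  push_cast at h2
  split_ifs at h2 with h3 h4 h4 <;> simp only [h3, h4] <;> omega

theorem relIndex_ratIdeals_sqrtRatIdeals [IsGalois ℚ k] :
    (ratIdeals k).relIndex (sqrtRatIdeals k) = 2 ^ (evenPrimes k).ncard := by
  classical
  set R := (finite_evenPrimes k).toFinset with hR
  have hsub : ∀ T ∈ R.powerset, ↑T ⊆ evenPrimes k := fun T hT p hp =>
    (finite_evenPrimes k).mem_toFinset.mp (Finset.mem_powerset.mp hT hp)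
  rw [Set.ncard_eq_toFinset_card _ (finite_evenPrimes k), ← Finset.card_powerset,
    Subgroup.relIndex, Subgroup.index, ← Nat.card_eq_finsetCard]
  symm
  let D := sqrtRatIdeals k
  let N := (ratIdeals k).subgroupOf D
  let f : R.powerset → D ⧸ N := fun T =>
    QuotientGroup.mk ⟨∏ p ∈ T.1, sqrtPrime k p, prod_sqrtPrime_mem (hsub T.1 T.2)⟩
  refine Nat.card_congr (Equiv.ofBijective f ⟨fun T T' h => ?_, fun c => ?_⟩)
  · obtain ⟨s, hs⟩ := (mem_ratIdeals k).mp
      (Subgroup.mem_subgroupOf.mp (QuotientGroup.eq.mp h.symm))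
    refine Subtype.ext (eq_of_prod_sqrtPrime_eq (hsub T.1 T.2) (hsub T'.1 T'.2) (s := s) ?_)
    rw [hs]
    exact (mul_inv_cancel_left _ _).symm
  · obtain ⟨⟨c, hc⟩, rfl⟩ := QuotientGroup.mk_surjective c
    obtain ⟨s, T, hT, rfl⟩ := exists_eq_ratIdeal_mul_prod_sqrtPrime hc
    refine ⟨⟨T, Finset.mem_powerset.mpr fun p hp =>
      (finite_evenPrimes k).mem_toFinset.mpr (hT hp)⟩, QuotientGroup.eq.mpr ?_⟩
    refine Subgroup.mem_subgroupOf.mpr ((mem_ratIdeals k).mpr ⟨s, ?_⟩)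
    change _ = (∏ p ∈ T, sqrtPrime k p)⁻¹ * (ratIdeal k s * ∏ p ∈ T, sqrtPrime k p)
    rw [mul_comm (ratIdeal k s), inv_mul_cancel_left]

end

/-! ### Ramification in `K` and in the quadratic subfields -/

theorem card_subgroup_of_card_eq_two {G : Type*} [Group G] (hG : Nat.card G = 2) {s : G}
    (hs : s ≠ 1) (H : Subgroup G) :
    (s ∈ H → Nat.card H = 2) ∧ (s ∉ H → Nat.card H = 1) := by
  have : Finite G := Nat.finite_of_card_ne_zero (by rw [hG]; decide)
  have huniv : ∀ g : G, g = 1 ∨ g = s := fun g => by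
    have h1 : ({1, s} : Set G) = Set.univ :=
      Set.eq_of_subset_of_ncard_le (Set.subset_univ _)
        (by rw [Set.ncard_univ, hG, Set.ncard_pair hs.symm])
    have h2 : g ∈ ({1, s} : Set G) := h1 ▸ Set.mem_univ g
    simpa using h2
  refine ⟨fun h => ?_, fun h => ?_⟩
  · have : H = ⊤ := eq_top_iff.mpr fun g _ => by
      rcases huniv g with rfl | rfl
      exacts [one_mem _, h]
    rw [this, Subgroup.card_top, hG]
  · have : H = ⊥ := eq_bot_iff.mpr fun g hg => by
      rcases huniv g with rfl | rfl
      exacts [rfl, absurd hg h]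
    rw [this, Subgroup.card_bot]

section

variable {K : Type*} [Field K] [NumberField K]

variable {k : Fin 3 → IntermediateField ℚ K} {σ : Fin 3 → Gal(K/ℚ)}

/-- The automorphism `σ i` as an automorphism over `k i`. -/
def IsConjSystem.lift (hσ : IsConjSystem k σ) (i : Fin 3) : Gal(K/(k i)) :=
  AlgEquiv.ofRingEquiv (f := (σ i).toRingEquiv) fun x => (hσ.apply_eq_iff i _).mpr x.2

theorem card_inertia_eq_ramIdx [IsGalois ℚ K] {p : Nat.Primes} {P : Ideal (𝓞 K)}
    (hP : P ∈ (Ideal.span {((p : ℕ) : ℤ)}).primesOver (𝓞 K)) :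
    Nat.card (P.inertia Gal(K/ℚ)) = ramIdx K p := by
  have := hP.1
  have := hP.2
  have : Finite (ℤ ⧸ Ideal.span {((p : ℕ) : ℤ)}) :=
    Ring.HasFiniteQuotients.finiteQuotient (span_prime_ne_bot p)
  have : Finite (Ideal.span {((p : ℕ) : ℤ)}).ResidueField :=
    Finite.of_surjective _ (Ideal.bijective_algebraMap_quotient_residueField _).2
  exact Ideal.card_inertia_eq_ramificationIdxIn _ P

theorem ramIdx_mul_card_inertia [IsGalois ℚ K] (F : IntermediateField ℚ K) [IsGalois ℚ F]
    {p : Nat.Primes} {P : Ideal (𝓞 K)}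
    (hP : P ∈ (Ideal.span {((p : ℕ) : ℤ)}).primesOver (𝓞 K)) :
    ramIdx F p * Nat.card (P.inertia Gal(K/F)) = ramIdx K p := by
  have := hP.1
  have := hP.2
  have h0 : P.under (𝓞 F) ≠ ⊥ := Ideal.under_ne_bot _ (ne_bot_of_mem_primesOver hP)
  have : (P.under (𝓞 F)).IsMaximal := Ideal.IsPrime.isMaximal inferInstance h0
  have : Finite (𝓞 F ⧸ P.under (𝓞 F)) := Ring.HasFiniteQuotients.finiteQuotient h0
  have : Finite (P.under (𝓞 F)).ResidueField :=
    Finite.of_surjective _ (Ideal.bijective_algebraMap_quotient_residueField _).2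
  have : (P.under (𝓞 F)).LiesOver (Ideal.span {((p : ℕ) : ℤ)}) := inferInstance
  have h1 := Ideal.card_inertia_eq_ramificationIdxIn (G := Gal(K/F)) (P.under (𝓞 F)) P
  rw [h1]
  exact Ideal.ramificationIdxIn_mul_ramificationIdxIn (p := Ideal.span {((p : ℕ) : ℤ)})
    (P.under (𝓞 F)) Gal(F/ℚ) (𝓞 K) Gal(K/ℚ) Gal(K/F)

/-- With `I` an inertia group above `p`, the index in `K` is `|I|` and that in `k i` is `|I| / |I ∩
{1, σ i}|`. As `I` is trivial, of order 2 or everything, the indices in the `k i` are 1, 1, 1, or 1,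
2, 2 in some order, or 2, 2, 2. -/
theorem IsConjSystem.ramIdx_cases [IsGalois ℚ K] (hK : IsKleinFour Gal(K/ℚ))
    (hσ : IsConjSystem k σ) (hk_deg : ∀ i, Module.finrank ℚ (k i) = 2) (p : Nat.Primes) :
    (ramIdx K p = 1 ∧ ∀ i, ramIdx (k i) p = 1) ∨
      (Even (ramIdx K p) ∧ (∀ i, ramIdx (k i) p = 1 ∨ ramIdx (k i) p = 2) ∧
        ramIdx K p * 2 = ∏ i, ramIdx (k i) p) := by
  obtain ⟨⟨P, hP⟩⟩ : Nonempty ((Ideal.span {((p : ℕ) : ℤ)}).primesOver (𝓞 K)) := inferInstance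
  have hI := card_inertia_eq_ramIdx hP
  have hKdeg : Module.finrank ℚ K = 4 := by rw [← IsGalois.card_aut_eq_finrank, hK.card_four]
  have hstep : ∀ i, (σ i ∈ P.inertia Gal(K/ℚ) → ramIdx (k i) p * 2 = ramIdx K p) ∧
      (σ i ∉ P.inertia Gal(K/ℚ) → ramIdx (k i) p = ramIdx K p) := fun i => by
    have hgal : IsGalois ℚ (k i) := (exists_conj_of_finrank_eq_two (hk_deg i)).1
    have hcard : Nat.card Gal(K/(k i)) = 2 := by
      have := Module.finrank_mul_finrank ℚ (k i) K
      rw [hk_deg, hKdeg] at this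
      rw [IsGalois.card_aut_eq_finrank]
      omega
    have hne : hσ.lift i ≠ 1 := fun h => hσ.ne_one i (AlgEquiv.ext fun x => by
      exact congrArg (fun τ : Gal(K/(k i)) => τ x) h)
    have h1 := ramIdx_mul_card_inertia (k i) hP
    have h2 := card_subgroup_of_card_eq_two hcard hne (P.inertia Gal(K/(k i)))
    have h3 : hσ.lift i ∈ P.inertia Gal(K/(k i)) ↔ σ i ∈ P.inertia Gal(K/ℚ) := Iff.rfl
    refine ⟨fun h => ?_, fun h => ?_⟩
    · rw [← h1, h2.1 (h3.mpr h)]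
    · rw [← h1, h2.2 (mt h3.mp h), mul_one]
  by_cases h0 : ∃ i, σ i ∈ P.inertia Gal(K/ℚ)
  · obtain ⟨i, hi⟩ := h0
    right
    by_cases h1 : ∃ j, j ≠ i ∧ σ j ∈ P.inertia Gal(K/ℚ)
    · obtain ⟨j, hj, hjI⟩ := h1
      have hall : ∀ l, σ l ∈ P.inertia Gal(K/ℚ) := fun l => by
        by_cases hli : l = i
        · rwa [hli]
        by_cases hlj : l = j
        · rwa [hlj]
        have : σ l = σ i * σ j := AlgEquiv.ext fun x =>
          (hσ.apply_apply_of_ne hK hj.symm hli hlj x).symm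
        rw [this]
        exact mul_mem hi hjI
      have htop : P.inertia Gal(K/ℚ) = ⊤ := eq_top_iff.mpr fun g _ => by
        by_cases hg : g = 1
        · rw [hg]
          exact one_mem _
        · obtain ⟨l, rfl⟩ := hσ.eq_of_ne_one g hg
          exact hall l
      rw [htop, Subgroup.card_top, hK.card_four] at hI
      have h2 : ∀ l, ramIdx (k l) p = 2 := fun l => by
        have := (hstep l).1 (hall l)
        omega
      refine ⟨by rw [← hI]; decide, fun l => .inr (h2 l), ?_⟩
      rw [← hI]
      simp [h2]
    · push Not at h1
      have hset : ((P.inertia Gal(K/ℚ) : Subgroup _) : Set Gal(K/ℚ)) = {1, σ i} := by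
        ext g
        constructor
        · intro hg
          by_cases hg1 : g = 1
          · exact .inl hg1
          · obtain ⟨l, rfl⟩ := hσ.eq_of_ne_one g hg1
            by_cases hl : l = i
            · exact .inr (by rw [hl]; rfl)
            · exact absurd hg (h1 l hl)
        · rintro (rfl | rfl)
          exacts [one_mem _, hi]
      have h2 : ramIdx K p = 2 := by
        rw [← hI, ← Set.ncard_pair (hσ.ne_one i).symm, ← hset]
        rfl
      have h3 : ramIdx (k i) p = 1 := by
        have := (hstep i).1 hi
        omega
      have h4 : ∀ j, j ≠ i → ramIdx (k j) p = 2 := fun j hj => by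
        rw [(hstep j).2 (h1 j hj), h2]
      refine ⟨by rw [h2]; decide, fun j => ?_, ?_⟩
      · by_cases hj : j = i
        · rw [hj]
          exact .inl h3
        · exact .inr (h4 j hj)
      · rw [h2, ← Finset.mul_prod_erase _ _ (Finset.mem_univ i), h3,
          Finset.prod_congr rfl fun j hj => h4 j (Finset.ne_of_mem_erase hj)]
        simp
  · push Not at h0
    left
    have hbot : P.inertia Gal(K/ℚ) = ⊥ := eq_bot_iff.mpr fun g hg => by
      by_contra hg1
      obtain ⟨l, rfl⟩ := hσ.eq_of_ne_one g hg1
      exact h0 l hg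
    rw [hbot, Subgroup.card_bot] at hI
    exact ⟨hI.symm, fun i => ((hstep i).2 (h0 i)).trans hI.symm⟩

theorem IsConjSystem.mem_evenPrimes_iff [IsGalois ℚ K] (hK : IsKleinFour Gal(K/ℚ))
    (hσ : IsConjSystem k σ) (hk_deg : ∀ i, Module.finrank ℚ (k i) = 2) {p : Nat.Primes} :
    p ∈ evenPrimes K ↔ ∃ i, p ∈ evenPrimes (k i) := by
  constructor
  · intro hp
    have hp : Even (ramIdx K p) := hp
    by_contra! h
    rcases hσ.ramIdx_cases hK hk_deg p with ⟨h1, -⟩ | ⟨-, h1, h2⟩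
    · rw [h1] at hp
      exact absurd hp (by decide)
    · have h3 : ∀ i, ramIdx (k i) p = 1 := fun i => (h1 i).resolve_right fun h3 => h i (by
        change Even _
        rw [h3]
        decide)
      simp only [h3, Finset.prod_const_one] at h2
      omega
  · rintro ⟨i, hi⟩
    have hi : Even (ramIdx (k i) p) := hi
    rcases hσ.ramIdx_cases hK hk_deg p with ⟨-, h1⟩ | ⟨h1, -⟩
    · rw [h1] at hi
      exact absurd hi (by decide)
    · exact h1

/-- This is the product of the local identities of `ramIdx_cases` over the primes that ramify in
`K`. -/
theorem IsConjSystem.ramificationProduct_mul [IsGalois ℚ K] (hK : IsKleinFour Gal(K/ℚ))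
    (hσ : IsConjSystem k σ) (hk_deg : ∀ i, Module.finrank ℚ (k i) = 2) :
    ramificationProduct K * 2 ^ (evenPrimes K).ncard = ∏ i, 2 ^ (evenPrimes (k i)).ncard := by
  classical
  have hfin := finite_evenPrimes K
  have hK1 : ramificationProduct K = ∏ p ∈ hfin.toFinset, ramIdx K p := by
    refine finprod_eq_prod_of_mulSupport_subset _ fun p hp => ?_
    rw [Finset.mem_coe, Set.Finite.mem_toFinset]
    rcases hσ.ramIdx_cases hK hk_deg p with ⟨h1, -⟩ | ⟨h1, -⟩
    · exact absurd h1 hp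
    · exact h1
  have hk1 : ∀ i, 2 ^ (evenPrimes (k i)).ncard = ∏ p ∈ hfin.toFinset, ramIdx (k i) p := fun i => by
    have h1 : ∀ p ∈ hfin.toFinset, ramIdx (k i) p = if p ∈ evenPrimes (k i) then 2 else 1 :=
      fun p hp => by
        rcases hσ.ramIdx_cases hK hk_deg p with ⟨-, h1⟩ | ⟨-, h1, -⟩
        · rw [if_neg, h1 i]
          intro h
          have h : Even (ramIdx (k i) p) := h
          rw [h1] at h
          exact absurd h (by decide)
        · rcases h1 i with h | h
          · rw [if_neg, h]
            intro h'
            have h' : Even (ramIdx (k i) p) := h'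
            rw [h] at h'
            exact absurd h' (by decide)
          · rw [if_pos, h]
            change Even _
            rw [h]
            decide
    rw [Finset.prod_congr rfl h1, Finset.prod_ite, Finset.prod_const, Finset.prod_const_one,
      mul_one, ← Set.ncard_coe_finset]
    congr 2
    ext p
    simp only [Finset.coe_filter, Set.Finite.mem_toFinset, Set.mem_ofPred_eq]
    exact ⟨fun h => ⟨(hσ.mem_evenPrimes_iff hK hk_deg).mpr ⟨i, h⟩, h⟩, fun h => h.2⟩
  rw [hK1, Finset.prod_congr rfl fun i _ => hk1 i, Finset.prod_comm,
    Set.ncard_eq_toFinset_card _ hfin, ← Finset.prod_const, ← Finset.prod_mul_distrib]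
  refine Finset.prod_congr rfl fun p hp => ?_
  rcases hσ.ramIdx_cases hK hk_deg p with ⟨h1, -⟩ | ⟨-, -, h1⟩
  · have hp : Even (ramIdx K p) := hfin.mem_toFinset.mp hp
    rw [h1] at hp
    exact absurd hp (by decide)
  · exact h1

end

/-! ### Classes of ideals with rational square, and the Pólya group -/

section

variable (k : Type*) [Field k] [NumberField k]

/-- The classes of the ideals whose square is generated by a rational number. -/
def sqrtClasses : Subgroup (ClassGroup (𝓞 k)) := (sqrtRatIdeals k).map (ClassGroup.mk k)

theorem ker_classGroup_mk :
    (ClassGroup.mk k : (FractionalIdeal (𝓞 k)⁰ k)ˣ →* ClassGroup (𝓞 k)).ker =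
      (toPrincipalIdeal (𝓞 k) k).range := by
  ext c
  have h : Units.mapEquiv (FractionalIdeal.canonicalEquiv (𝓞 k)⁰ k k).toMulEquiv c = c :=
    Units.ext (by simp)
  rw [MonoidHom.mem_ker, ← (ClassGroup.equiv (R := 𝓞 k) k).map_eq_one_iff, ClassGroup.equiv_mk]
  erw [h]
  exact QuotientGroup.eq_one_iff c

theorem ratIdeals_le_range : ratIdeals k ≤ (toPrincipalIdeal (𝓞 k) k).range :=
  Subgroup.map_le_range _ _

theorem ratIdeals_le_sqrtRatIdeals : ratIdeals k ≤ sqrtRatIdeals k := fun _ hc =>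
  pow_mem hc 2

theorem classGroup_mk_ratIdeal (r : ℚˣ) : ClassGroup.mk k (ratIdeal k r) = 1 := by
  rw [← MonoidHom.mem_ker, ker_classGroup_mk]
  exact ratIdeals_le_range k ((mem_ratIdeals k).mpr ⟨r, rfl⟩)

theorem card_sqrtClasses_mul :
    (ratIdeals k).relIndex (sqrtRatIdeals k ⊓ (toPrincipalIdeal (𝓞 k) k).range) *
      Nat.card (sqrtClasses k) = (ratIdeals k).relIndex (sqrtRatIdeals k) := by
  rw [sqrtClasses, ← Subgroup.relIndex_ker, ker_classGroup_mk,
    ← Subgroup.inf_relIndex_left (sqrtRatIdeals k)]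
  exact Subgroup.relIndex_mul_relIndex _ _ _
    (le_inf (ratIdeals_le_sqrtRatIdeals k) (ratIdeals_le_range k)) inf_le_left

theorem classGroup_mk_radUnit (p : Nat.Primes) : ClassGroup.mk k (radUnit k p) =
    ClassGroup.mk0 ⟨radIdeal k p, radIdeal_mem_nonZeroDivisors k p⟩ :=
  ClassGroup.mk_mk0 k _

variable [IsGalois ℚ k]

theorem mk0_radIdeal_mem_polyaGroup (p : Nat.Primes) :
    ClassGroup.mk0 ⟨radIdeal k p, radIdeal_mem_nonZeroDivisors k p⟩ ∈ polyaGroup k := by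
  obtain ⟨q, hq⟩ := exists_polyaIdeal_eq_radIdeal k p
  simp only [← hq]
  exact Subgroup.subset_closure ⟨q, rfl⟩

/-- Each `sqrtPrime` is a power of the radical. When the ramification index is 4 it is the square of
the radical, which is why this is only an inclusion. -/
theorem sqrtClasses_le_polyaGroup : sqrtClasses k ≤ polyaGroup k := by
  rintro _ ⟨c, hc, rfl⟩
  obtain ⟨s, T, -, rfl⟩ := exists_eq_ratIdeal_mul_prod_sqrtPrime hc
  rw [map_mul, classGroup_mk_ratIdeal, one_mul, map_prod]
  refine prod_mem fun p _ => ?_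
  rw [sqrtPrime, map_pow, classGroup_mk_radUnit]
  exact pow_mem (mk0_radIdeal_mem_polyaGroup k p) _

theorem radUnit_mem_sqrtRatIdeals {p : Nat.Primes} (h : ramIdx k p = 1 ∨ ramIdx k p = 2) :
    radUnit k p ∈ sqrtRatIdeals k := by
  rw [mem_sqrtRatIdeals]
  have h1 := radUnit_pow_ramIdx k p
  rcases h with h | h <;> rw [h] at h1
  · exact ⟨primeUnit p ^ 2, by rw [map_pow, ← h1, pow_one]⟩
  · exact ⟨primeUnit p, h1.symm⟩

theorem polyaGroup_eq_sqrtClasses (h : ∀ p, ramIdx k p = 1 ∨ ramIdx k p = 2) :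
    polyaGroup k = sqrtClasses k := by
  refine le_antisymm ((Subgroup.closure_le _).mpr ?_) (sqrtClasses_le_polyaGroup k)
  rintro _ ⟨q, rfl⟩
  rcases polyaIdeal_eq_one_or_radIdeal k q with h1 | ⟨p, h1⟩ <;> simp only [h1]
  · exact (map_one (ClassGroup.mk0 (R := 𝓞 k))).symm ▸ one_mem (sqrtClasses k)
  · rw [← classGroup_mk_radUnit]
    exact Subgroup.mem_map_of_mem _ (radUnit_mem_sqrtRatIdeals k (h p))

end

/-! ### Extension of ideals to `K` and the image of ψ -/

section

variable {K : Type*} [Field K] [NumberField K]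

/-- Extension of fractional ideals from a subfield. -/
def extendUnits (F : IntermediateField ℚ K) :
    (FractionalIdeal (𝓞 F)⁰ F)ˣ →* (FractionalIdeal (𝓞 K)⁰ K)ˣ :=
  Units.map (FractionalIdeal.extendedHom K (𝓞 K)).toMonoidHom

theorem extendUnits_ratIdeal (F : IntermediateField ℚ K) (r : ℚˣ) :
    extendUnits F (ratIdeal F r) = ratIdeal K r := by
  ext1
  change FractionalIdeal.extendedHom K (𝓞 K) (ratIdeal F r : FractionalIdeal (𝓞 F)⁰ F) = _
  rw [coe_ratIdeal, coe_ratIdeal, FractionalIdeal.extendedHom_spanSingleton]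
  simp

theorem extendUnits_mem_sqrtRatIdeals {F : IntermediateField ℚ K}
    {c : (FractionalIdeal (𝓞 F)⁰ F)ˣ} (hc : c ∈ sqrtRatIdeals F) :
    extendUnits F c ∈ sqrtRatIdeals K := by
  obtain ⟨r, hr⟩ := (mem_sqrtRatIdeals F).mp hc
  exact (mem_sqrtRatIdeals K).mpr ⟨r, by rw [← map_pow, ← hr, extendUnits_ratIdeal]⟩

theorem extendedHom_mk0_eq (F : IntermediateField ℚ K) (I : (Ideal (𝓞 F))⁰) :
    ClassGroup.extendedHom (𝓞 F) (𝓞 K) (ClassGroup.mk0 I) =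
      ClassGroup.mk K (extendUnits F (FractionalIdeal.mk0 F I)) := by
  rw [ClassGroup.extendedHom_mk0, ← ClassGroup.mk_mk0 K]
  congr 1
  ext1
  exact (FractionalIdeal.extendedHom_coeIdeal_eq_map _ _ _).symm

theorem extendedHom_mk0_radIdeal (F : IntermediateField ℚ K) (p : Nat.Primes) :
    ClassGroup.extendedHom (𝓞 F) (𝓞 K)
      (ClassGroup.mk0 ⟨radIdeal F p, radIdeal_mem_nonZeroDivisors F p⟩) =
      ClassGroup.mk K (extendUnits F (radUnit F p)) :=
  extendedHom_mk0_eq F _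

theorem extendedHom_mem_sqrtClasses {F : IntermediateField ℚ K} [IsGalois ℚ F]
    (h : ∀ p, ramIdx F p = 1 ∨ ramIdx F p = 2) {x : ClassGroup (𝓞 F)} (hx : x ∈ polyaGroup F) :
    ClassGroup.extendedHom (𝓞 F) (𝓞 K) x ∈ sqrtClasses K := by
  suffices polyaGroup F ≤ (sqrtClasses K).comap (ClassGroup.extendedHom (𝓞 F) (𝓞 K)) from this hx
  refine (Subgroup.closure_le _).mpr ?_
  rintro _ ⟨q, rfl⟩
  rw [SetLike.mem_coe, Subgroup.mem_comap]
  rcases polyaIdeal_eq_one_or_radIdeal F q with h1 | ⟨p, h1⟩ <;> simp only [h1]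
  · have h2 : ClassGroup.mk0 (1 : (Ideal (𝓞 F))⁰) = 1 := map_one _
    erw [h2]
    rw [map_one]
    exact one_mem _
  · rw [extendedHom_mk0_radIdeal]
    exact Subgroup.mem_map_of_mem _ 
      (extendUnits_mem_sqrtRatIdeals (radUnit_mem_sqrtRatIdeals F (h p)))

variable {k : Fin 3 → IntermediateField ℚ K} {σ : Fin 3 → Gal(K/ℚ)}

theorem extendClasses_apply (x : ∀ i, polyaGroup (k i)) :
    extendClasses k x = ∏ i, ClassGroup.extendedHom (𝓞 (k i)) (𝓞 K) (x i) :=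
  MonoidHom.finsetProd_apply _ _ _

theorem card_ker_psi_mul (h : ∀ x, extendClasses k x ∈ polyaGroup K) :
    Nat.card (psi k h).ker * Nat.card (extendClasses k).range =
      ∏ i, Nat.card (polyaGroup (k i)) := by
  have h1 : (psi k h).ker = (extendClasses k).ker := by
    ext x
    rw [MonoidHom.mem_ker, MonoidHom.mem_ker, ← Subtype.coe_inj]
    rfl
  rw [h1, ← Subgroup.index_ker, Subgroup.card_mul_index, Nat.card_pi]

variable [IsGalois ℚ K]

/-- Both ideals have square `(p)`. -/
theorem extendUnits_radUnit {F : IntermediateField ℚ K} [IsGalois ℚ F] {p : Nat.Primes}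
    (hF : ramIdx F p = 2) (hK : p ∈ evenPrimes K) :
    extendUnits F (radUnit F p) = sqrtPrime K p := by
  apply sq_injective_fractionalIdeal
  rw [sqrtPrime_sq K hK, ← map_pow, ← hF, radUnit_pow_ramIdx, extendUnits_ratIdeal]

theorem IsConjSystem.ramIdx_quadratic (hK : IsKleinFour Gal(K/ℚ))
    (hσ : IsConjSystem k σ) (hk_deg : ∀ i, Module.finrank ℚ (k i) = 2) (i : Fin 3)
    (p : Nat.Primes) : ramIdx (k i) p = 1 ∨ ramIdx (k i) p = 2 := by
  rcases hσ.ramIdx_cases hK hk_deg p with ⟨-, h⟩ | ⟨-, h, -⟩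
  exacts [.inl (h i), h i]

/-- Extension preserves having a rational square. Conversely a prime with even index in `K` ramifies
in some `k i`, where its radical extends to `sqrtPrime K p`. -/
theorem IsConjSystem.range_extendClasses (hK : IsKleinFour Gal(K/ℚ))
    (hσ : IsConjSystem k σ) (hk_deg : ∀ i, Module.finrank ℚ (k i) = 2) :
    (extendClasses k).range = sqrtClasses K := by
  have hgal : ∀ i, IsGalois ℚ (k i) := fun i => (exists_conj_of_finrank_eq_two (hk_deg i)).1
  apply le_antisymm
  · rintro _ ⟨x, rfl⟩
    rw [extendClasses_apply]
    exact prod_mem fun i _ =>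
      extendedHom_mem_sqrtClasses (hσ.ramIdx_quadratic hK hk_deg i) (x i).2
  · rintro _ ⟨c, hc, rfl⟩
    obtain ⟨s, T, hT, rfl⟩ := exists_eq_ratIdeal_mul_prod_sqrtPrime hc
    rw [map_mul, classGroup_mk_ratIdeal, one_mul, map_prod]
    refine prod_mem fun p hp => ?_
    obtain ⟨i, hi⟩ := (hσ.mem_evenPrimes_iff hK hk_deg).mp (hT hp)
    have h2 : ramIdx (k i) p = 2 := (hσ.ramIdx_quadratic hK hk_deg i p).resolve_left fun h => by
      have hi : Even (ramIdx (k i) p) := hi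
      rw [h] at hi
      exact absurd hi (by decide)
    rw [← extendUnits_radUnit h2 (hT hp), ← extendedHom_mk0_radIdeal]
    refine ⟨Pi.mulSingle i ⟨_, mk0_radIdeal_mem_polyaGroup (k i) p⟩, ?_⟩
    rw [extendClasses_apply, Finset.prod_eq_single i]
    · rw [Pi.mulSingle_eq_same]
    · intro j _ hj
      rw [Pi.mulSingle_eq_of_ne hj, OneMemClass.coe_one, map_one]
    · exact fun h => absurd (Finset.mem_univ i) h

end

/-! ### Combining the index formulas -/

section

/-- `KK` is |Ker ψ|, `E` is ∏ e_p, `RK` is 2 ^ rank K. The letters C, T, X, V stand for |C|, 2^t, X,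
V of the opening sketch, with suffix K for `K` and prefix P for the product over the `k i`; 4 and 8
= 2³ are the orders of the 2-torsion. -/
theorem mul_two_mul_eq_of_index_relations {KK CK PC E TK PT XK VK RK PX PV q c : ℕ}
    (hTK : TK ≠ 0) (hRK : RK ≠ 0) (h1 : KK * CK = PC) (h2 : E * TK = PT) (h3 : PX * PC = PT)
    (h4 : XK * CK = TK) (h5 : XK * VK = RK * 4) (h6 : PX * PV = RK * 8)
    (h7 : VK * c = q * PV) : KK * (2 * q) = E * c := by
  have h0 : TK * (PX * PV) ≠ 0 := by
    rw [h6]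
    positivity
  refine mul_right_cancel₀ h0 ?_
  zify at *
  linear_combination (-KK * 2 * q * PX * PV) * h4 + (2 * q * XK * PX * PV) * h1 +
    (2 * q * XK * PV) * h3 - (2 * q * XK * PV) * h2 - (E * TK * 2 * XK) * h7 +
    (E * TK * 2 * c) * h5 - (E * TK * c) * h6

variable {K : Type*} [Field K] [NumberField K] [IsGalois ℚ K]

variable {k : Fin 3 → IntermediateField ℚ K} {σ : Fin 3 → Gal(K/ℚ)}

theorem IsConjSystem.card_ker_psi_mul_two_mul_unitIndex (hK : IsKleinFour Gal(K/ℚ))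
    (hσ : IsConjSystem k σ) (hk_deg : ∀ i, Module.finrank ℚ (k i) = 2)
    (h : ∀ x, extendClasses k x ∈ polyaGroup K) :
    Nat.card (psi k h).ker * (2 * unitIndex k) = ramificationProduct K *
      Nat.card (((ratSqUnits K).comap (unitsProd k)).map (unitSigns k)) := by
  have hgal : ∀ i, IsGalois ℚ (k i) := fun i => (exists_conj_of_finrank_eq_two (hk_deg i)).1
  have hA : ∀ i, Nat.card (powMonoidHom 2 : RatClass (k i) →* _).ker = 2 := fun i => by
    obtain ⟨-, h1, h2, -⟩ := exists_conj_of_finrank_eq_two (hk_deg i)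
    rw [card_ker_sq_ratClass _ h1, h2]
  have hAK : Nat.card (powMonoidHom 2 : RatClass K →* _).ker = 4 := by
    rw [card_ker_sq_ratClass _ hK.exponent_two, hK.card_four]
  have hfin : ∀ i, Finite (powMonoidHom 2 : RatClass (k i) →* _).ker := fun i =>
    Nat.finite_of_card_ne_zero (by rw [hA]; decide)
  have hfinK : Finite (powMonoidHom 2 : RatClass K →* _).ker :=
    Nat.finite_of_card_ne_zero (by rw [hAK]; decide)
  have hC := card_ker_psi_mul h
  rw [hσ.range_extendClasses hK hk_deg, Finset.prod_congr rfl fun i _ => by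
    rw [polyaGroup_eq_sqrtClasses (k i) (hσ.ramIdx_quadratic hK hk_deg i)]] at hC
  have hE := hσ.ramificationProduct_mul hK hk_deg
  have hXC := card_sqrtClasses_mul K
  rw [relIndex_ratIdeals_sqrtRatIdeals] at hXC
  have hXCk : (∏ i, (ratIdeals (k i)).relIndex
      (sqrtRatIdeals (k i) ⊓ (toPrincipalIdeal (𝓞 (k i)) (k i)).range)) *
      ∏ i, Nat.card (sqrtClasses (k i)) = ∏ i, 2 ^ (evenPrimes (k i)).ncard := by
    rw [← Finset.prod_mul_distrib]
    exact Finset.prod_congr rfl fun i _ => by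
      rw [card_sqrtClasses_mul, relIndex_ratIdeals_sqrtRatIdeals]
  have hXV := relIndex_ratIdeals_mul_index_ratSqUnits K
  rw [hAK] at hXV
  have hXVk : (∏ i, (ratIdeals (k i)).relIndex
      (sqrtRatIdeals (k i) ⊓ (toPrincipalIdeal (𝓞 (k i)) (k i)).range)) *
      ∏ i, (ratSqUnits (k i)).index = 2 ^ Units.rank K * 8 := by
    rw [← Finset.prod_mul_distrib, rank_eq_sum_rank hK hσ hk_deg, ← Finset.prod_pow_eq_pow_sum,
      Finset.prod_congr rfl fun i _ => by
        rw [relIndex_ratIdeals_mul_index_ratSqUnits, hA], Finset.prod_mul_distrib]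
    simp
  have hU := index_ratSqUnits_mul_card hK hσ hk_deg
  exact mul_two_mul_eq_of_index_relations (by positivity) (by positivity) hC hE hXCk hXC hXV hXVk hU

/-- An infinite index has the value 0. Finiteness follows because the index of `ratSqUnits K`
divides a power of 2. -/
theorem IsConjSystem.unitIndex_ne_zero (hK : IsKleinFour Gal(K/ℚ))
    (hσ : IsConjSystem k σ) (hk_deg : ∀ i, Module.finrank ℚ (k i) = 2) : unitIndex k ≠ 0 := by
  have hAK : Nat.card (powMonoidHom 2 : RatClass K →* _).ker = 4 := by
    rw [card_ker_sq_ratClass _ hK.exponent_two, hK.card_four]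
  have hfinK : Finite (powMonoidHom 2 : RatClass K →* _).ker :=
    Nat.finite_of_card_ne_zero (by rw [hAK]; decide)
  have hXV := relIndex_ratIdeals_mul_index_ratSqUnits K
  rw [hAK] at hXV
  have hU := index_ratSqUnits_mul_card hK hσ hk_deg
  intro h
  rw [h, zero_mul] at hU
  rcases Nat.mul_eq_zero.mp hU with h | h
  · rw [h, mul_zero] at hXV
    exact absurd hXV (by positivity)
  · exact Nat.card_pos.ne' h

theorem IsConjSystem.card_signs (hK : IsKleinFour Gal(K/ℚ))
    (hσ : IsConjSystem k σ) (hk_deg : ∀ i, Module.finrank ℚ (k i) = 2) :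
    ((IsTotallyReal K ∧ ∀ i, nu (k i) = 0) →
      Nat.card (((ratSqUnits K).comap (unitsProd k)).map (unitSigns k)) = 2) ∧
    (¬ (IsTotallyReal K ∧ ∀ i, nu (k i) = 0) →
      Nat.card (((ratSqUnits K).comap (unitsProd k)).map (unitSigns k)) = 1) := by
  by_cases hreal : IsTotallyReal K
  · have : ∀ i, IsTotallyReal (k i) := fun i => IsTotallyReal.of_algebra (k i) K
    let φ : K →+* ℂ := Classical.arbitrary _
    have h := card_signs_of_real hσ hk_deg (IsTotallyReal.complexEmbedding_isReal φ).embedding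
    simpa only [hreal, true_and, nu_eq_zero_iff (hk_deg _)] using h
  · obtain ⟨φ, i, hφ⟩ := exists_conj_of_not_isTotallyReal hσ hreal
    exact ⟨fun h => absurd h.1 hreal, fun _ => card_signs_of_conj hK hσ hk_deg φ hφ⟩

end

end Biquadratic

end

theorem mainTheorem1 {K : Type*} [Field K] [NumberField K] [IsGalois ℚ K]
    (hK : IsKleinFour Gal(K/ℚ))
    (k : Fin 3 → IntermediateField ℚ K) (hk_inj : Function.Injective k)
    (hk_deg : ∀ i, Module.finrank ℚ (k i) = 2) :
    ∃ h : ∀ x, Biquadratic.extendClasses k x ∈ Biquadratic.polyaGroup K,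
      ((NumberField.IsTotallyReal K ∧ ∀ i, Biquadratic.nu (k i) = 0) →
        (Nat.card (Biquadratic.psi k h).ker : ℚ) =
          1 / (Biquadratic.unitIndex k : ℚ) * (Biquadratic.ramificationProduct K : ℚ)) ∧
      (¬ (NumberField.IsTotallyReal K ∧ ∀ i, Biquadratic.nu (k i) = 0) →
        (Nat.card (Biquadratic.psi k h).ker : ℚ) =
          1 / (2 * (Biquadratic.unitIndex k : ℚ)) * (Biquadratic.ramificationProduct K : ℚ)) := by
  obtain ⟨σ, hσ⟩ := Biquadratic.exists_isConjSystem hK k hk_inj hk_deg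
  -- ψ is well defined because its image is `sqrtClasses K`, which lies in Po(K).
  have h : ∀ x, Biquadratic.extendClasses k x ∈ Biquadratic.polyaGroup K := fun x =>
    Biquadratic.sqrtClasses_le_polyaGroup K (hσ.range_extendClasses hK hk_deg ▸ ⟨x, rfl⟩)
  have hmain := hσ.card_ker_psi_mul_two_mul_unitIndex hK hk_deg h
  have hq : (Biquadratic.unitIndex k : ℚ) ≠ 0 := by
    exact_mod_cast hσ.unitIndex_ne_zero hK hk_deg
  have hsigns := hσ.card_signs hK hk_deg
  refine ⟨h, fun hc => ?_, fun hc => ?_⟩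
  · rw [hsigns.1 hc] at hmain
    qify at hmain
    field_simp
    linear_combination hmain / 2
  · rw [hsigns.2 hc] at hmain
    qify at hmain
    field_simp
    linear_combination hmain
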